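/- **Setting.** Let $P=aX^4+bX^2+cX+d\in\mathbb{Q}[X]$ (here $c$ is a coefficient only) be irreducible with four real roots $x_1>x_2>x_3>x_4$ and with $[\mathbb{Q}(x_1,\dots,x_4):\mathbb{Q}]=24$, so that its Galois group is $S_4$. Put $\mathbb{D}=\prod_{j<l}(x_j-x_l)>0$ and assume that $\Delta=\mathbb{D}^2$ is an integer. Let $F=\mathbb{Q}(x_1,i\mathbb{D})\subset\mathbb{C}$, and for $j=1,\dots,4$ let $\varphi_j:F\to\mathbb{C}$ be the embedding with $\varphi_j(x_1)=x_j$, $\varphi_j(i\mathbb{D})=(-1)^{j+1}i\mathbb{D}$; the other four embeddings are the complex conjugates $\varphi_{\bar j}$. Let $\Lambda\subset\mathbb{C}^4$ be the image of the ring of integers of $F$ under $(\varphi_1,\dots,\varphi_4)$, and let $X=\mathbb{C}^4/\Lambda$, with coordinates $z_1,\dots,z_4$. The complex cohomology of $X$ is identified with the translation-invariant forms, and $\langle\cdot\rangle$ is integration over $X$ with its complex orientation. Write $dz_{\varphi_j}=dz_j$ and $dz_{\varphi_{\bar j}}=d\bar z_j$. Let $G=\mathrm{Gal}(\mathbb{Q}(x_1,\dots,x_4,i)/\mathbb{Q})\cong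 S_4\times\{1,\rho\}$, where $\rho$ is complex conjugation; it acts on the embeddings by $\varphi\mapsto g\circ\varphi$. Put $$\omega=\frac{i\mathbb{D}}{\Delta}\sum_{j=1}^4(-1)^{j+1}\mu_j\,dz_j\wedge d\bar z_j,\qquad \mu_j=\prod_{l\ne j}(x_j-x_l),$$ $$M=\mathbb{D}\,(dz_1\wedge d\bar z_2\wedge dz_3\wedge d\bar z_4+d\bar z_1\wedge dz_2\wedge d\bar z_3\wedge dz_4).$$ With $h=(x_1x_3+x_2x_4)(x_1-x_3)$ and a nonzero integer $c$, let $A_1$ and $A_2$ be the 2-forms obtained by summing, over the twelve terms of the $G$-orbit of the unordered pair $\{\varphi_1,\varphi_3\}$, $$A_1=\sum g(h)\,dz_{g\varphi_1}\wedge dz_{g\varphi_3},\qquad A_2=\sum g(ic\mathbb{D}\,h)\,dz_{g\varphi_1}\wedge dz_{g\varphi_3}.$$ **Theorem.** Let $k$ be a positive integer, and let $L_1$, $L_2$, $L_{k\omega}$ be smooth complex line bundles on $X$ with first Chern classes $A_1$, $A_2$, $k\omega$ (for example $L_{k\omega}$ an ample holomorphic line bundle with class $k\omega$). Put $$\mathcal{E}=\left(L_1\otimes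 L_{k\omega}\oplus L_1^{-1}\otimes L_{k\omega}\right)^{\oplus c^2\Delta}\ominus\left(L_2\oplus L_2^{-1}\right).$$ Then $$ch(\mathcal{E})=2c^2\Delta k\,\omega+4c^2\Delta\,M+k^2c^2\Delta\,\omega^2+\rho_0+\rho_6+\rho_8,$$ where $\rho_0,\rho_6,\rho_8$ are rational classes, $\rho_0$ of degree $0$, $\rho_6$ of type $(3,3)$ and $\rho_8$ of degree $8$. Moreover $\mathcal{E}$ has positive rank $r=2(c^2\Delta-1)$, and it satisfies the Bogomolov inequality strictly: $$\langle c_2(\mathcal{E})\,\omega^2\rangle-\frac{r-1}{2r}\langle c_1(\mathcal{E})^2\omega^2\rangle=\frac{c^2\Delta}{c^2\Delta-1}\,k^2\langle\omega^4\rangle>0 .$$ -/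

import Mathlib

open scoped ContDiff

namespace AbelianFourfold

noncomputable section

/-! ### Translation-invariant forms on `V = ℂ⁴` -/

/-- The real vector space `V = ℂ⁴`, universal cover of the torus `V / Λ`. -/
abbrev V : Type := Fin 4 → ℂ

/-- Complex-valued real-linear functionals on `V`. -/
abbrev W : Type := V →L[ℝ] ℂ

/-- The algebra of translation-invariant complex differential forms on `V`; it is identified with
`H^*(V / Λ, ℂ)` for every lattice `Λ`. Multiplication is the wedge product. -/
abbrev Form : Type := ExteriorAlgebra ℂ W

instance finite_W : Module.Finite ℂ W :=
  haveI : Module.Finite ℝ W := Module.Finite.equiv (LinearMap.toContinuousLinearMap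
    (𝕜 := ℝ) (E := V) (F' := ℂ))
  Module.Finite.of_restrictScalars_finite ℝ ℂ W

/-- Coordinates on the finite-dimensional space of forms. -/
def formCoord : Form ≃ₗ[ℂ] (Finset (Fin (Module.finrank ℂ W)) → ℂ) :=
  (Module.finBasis ℂ W).ExteriorAlgebra.equivFun

/-- A norm on the finite-dimensional space of forms. All norms on it are equivalent, and this one
is used only to speak of smooth form-valued functions and of their derivatives. -/
instance formNormedAddCommGroup : NormedAddCommGroup Form :=
  NormedAddCommGroup.induced Form (Finset (Fin (Module.finrank ℂ W)) → ℂ) formCoord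
    formCoord.injective

instance formNormedSpace : NormedSpace ℂ Form :=
  NormedSpace.induced ℂ Form (Finset (Fin (Module.finrank ℂ W)) → ℂ) formCoord

/-- A functional regarded as an invariant 1-form. -/
abbrev oneForm (f : W) : Form := ExteriorAlgebra.ι ℂ f

/-- The coordinate functional `z_j`. -/
def zFun (j : Fin 4) : W := ContinuousLinearMap.proj j

/-- The conjugate coordinate functional. -/
def zbarFun (j : Fin 4) : W := (Complex.conjCLE : ℂ →L[ℝ] ℂ).comp (zFun j)

/-- The invariant form `dz_j`. -/
def dz (j : Fin 4) : Form := oneForm (zFun j)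

/-- The invariant form `d\bar z_j`. -/
def dzbar (j : Fin 4) : Form := oneForm (zbarFun j)

/-- The real part `x_j` of `z_j`, as a complex-valued functional. -/
def xFun (j : Fin 4) : W := (Complex.ofRealCLM.comp Complex.reCLM).comp (zFun j)

/-- The imaginary part `y_j` of `z_j`, as a complex-valued functional. -/
def yFun (j : Fin 4) : W := (Complex.ofRealCLM.comp Complex.imCLM).comp (zFun j)

/-- The exterior derivative `dη = ∑_j dx_j ∧ ∂η/∂x_j + dy_j ∧ ∂η/∂y_j` of a differential form on
`V`, a form being a function with values in the invariant forms. -/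
def extD (η : V → Form) (v : V) : Form :=
  ∑ j : Fin 4, (oneForm (xFun j) * fderiv ℝ η v (Pi.single j 1)
    + oneForm (yFun j) * fderiv ℝ η v (Pi.single j Complex.I))

/-- The component of degree `m`. -/
def degPart (m : ℕ) (α : Form) : Form :=
  GradedRing.proj (fun i : ℕ => ⋀[ℂ]^i W) m α

/-- The forms of type `(1,0)`. -/
def type10 : Submodule ℂ Form :=
  Submodule.span ℂ {α | ∃ f : V →L[ℂ] ℂ, α = oneForm (f.restrictScalars ℝ)}

/-- The forms of type `(0,1)`. -/
def type01 : Submodule ℂ Form :=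
  Submodule.span ℂ {α | ∃ f : V →L[ℂ] ℂ,
    α = oneForm ((Complex.conjCLE : ℂ →L[ℝ] ℂ).comp (f.restrictScalars ℝ))}

/-- The forms of type `(p,q)`: sums of products of `p` forms of type `(1,0)` and `q` forms of
type `(0,1)`. -/
def hodgeType (p q : ℕ) : Submodule ℂ Form := type10 ^ p * type01 ^ q

/-! ### Cohomology and vector bundles on the torus `V / Λ` -/

/-- The rational cohomology ring `H^*(V / Λ, ℚ)` inside the invariant forms: it is generated by
`H¹(V / Λ, ℚ)`, the functionals with rational values on `Λ`. -/
def rationalClasses (Λ : Submodule ℤ V) : Subalgebra ℚ Form :=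
  Algebra.adjoin ℚ {α | ∃ f : W, (∀ l ∈ Λ, ∃ q : ℚ, f l = (q : ℂ)) ∧ α = oneForm f}

/-- The value of a form on `(e₁, i e₁, …, e₄, i e₄)`; components of degree other than 8 are
discarded. -/
def topCoeff : Form →ₗ[ℂ] ℂ :=
  ExteriorAlgebra.liftAlternating (Pi.single 8
    ((Matrix.detRowAlternating (R := ℂ) (n := Fin 8)).compLinearMap
      (LinearMap.pi fun a : Fin 8 =>
        { toFun := fun f : W =>
            f (Pi.single ⟨a.val / 2, by omega⟩ (Complex.I ^ (a.val % 2)))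
          map_add' := fun _ _ => rfl
          map_smul' := fun _ _ => rfl })))

/-- Integration `⟨α⟩ = ∫_{V / Λ} α` of an invariant form against the fundamental class given by
the complex orientation. -/
def integral (Λ : Submodule ℤ V) (α : Form) : ℂ :=
  (ZLattice.covolume Λ MeasureTheory.volume : ℂ) * topCoeff α

/-- The `Λ`-periodic form `η` represents the class of the invariant form `α` in the de Rham
cohomology of `V / Λ`: they differ by the derivative of a smooth `Λ`-periodic form. -/
def Represents (Λ : Submodule ℤ V) (η : V → Form) (α : Form) : Prop :=
  ∃ β : V → Form, ContDiff ℝ ∞ β ∧ (∀ l ∈ Λ, ∀ v, β (v + l) = β v) ∧ ∀ v, η v = α + extD β v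

/-- A smooth complex vector bundle on `V / Λ`, with fibre `ℂ^ι`, given by its factor of
automorphy: it is the quotient of `V × ℂ^ι` by `(v, s) ∼ (v + l, e_l(v) s)`, `l ∈ Λ`. Since `V` is
contractible every bundle is of this form up to isomorphism. -/
structure Bundle (Λ : Submodule ℤ V) (ι : Type) [Fintype ι] [DecidableEq ι] where
  e : Λ → V → Matrix ι ι ℂ
  smooth : ∀ l i j, ContDiff ℝ ∞ fun v => e l v i j
  e_zero : ∀ v, e 0 v = 1
  e_add : ∀ l m v, e (l + m) v = e l (v + m) * e m v

/-- A complex line bundle on `V / Λ`. -/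
abbrev LineBundle (Λ : Submodule ℤ V) : Type := Bundle Λ Unit

namespace Bundle

variable {Λ : Submodule ℤ V} {ι κ : Type} [Fintype ι] [DecidableEq ι] [Fintype κ] [DecidableEq κ]

/-- The direct sum. -/
def sum (E : Bundle Λ ι) (E' : Bundle Λ κ) : Bundle Λ (ι ⊕ κ) where
  e l v := Matrix.fromBlocks (E.e l v) 0 0 (E'.e l v)
  smooth l i j := by
    rcases i with i | i <;> rcases j with j | j
    · exact E.smooth l i j
    · exact contDiff_const
    · exact contDiff_const
    · exact E'.smooth l i j
  e_zero v := by simp [E.e_zero, E'.e_zero]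
  e_add l m v := by simp [E.e_add, E'.e_add, Matrix.fromBlocks_multiply]

/-- The direct sum of `n` copies. -/
def copies (n : ℕ) (E : Bundle Λ ι) : Bundle Λ (ι × Fin n) where
  e l v := Matrix.blockDiagonal fun _ => E.e l v
  smooth l i j := by
    by_cases h : i.2 = j.2
    · simpa [Matrix.blockDiagonal_apply, h] using E.smooth l i.1 j.1
    · simpa [Matrix.blockDiagonal_apply, h] using contDiff_const
  e_zero v := by
    simp only [E.e_zero]
    exact Matrix.blockDiagonal_one
  e_add l m v := by simp only [E.e_add, Matrix.blockDiagonal_mul]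

/-- The tensor product. -/
def tensor (E : Bundle Λ ι) (E' : Bundle Λ κ) : Bundle Λ (ι × κ) where
  e l v := Matrix.kroneckerMap (· * ·) (E.e l v) (E'.e l v)
  smooth l i j := (E.smooth l i.1 j.1).mul (E'.smooth l i.2 j.2)
  e_zero v := by simp [E.e_zero, E'.e_zero]
  e_add l m v := by
    rw [E.e_add, E'.e_add]
    exact Matrix.mul_kronecker_mul _ _ _ _

/-- The dual bundle, with factor of automorphy `(e_l(v)⁻¹)ᵀ = (e_{-l}(v + l))ᵀ`. For a line bundle
this is the inverse. -/
def dual (E : Bundle Λ ι) : Bundle Λ ι where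
  e l v := (E.e (-l) (v + l)).transpose
  smooth l i j := (E.smooth (-l) j i).comp (contDiff_id.add contDiff_const)
  e_zero v := by simp [E.e_zero]
  e_add l m v := by
    rw [show -(l + m) = -m + -l by abel, E.e_add, Matrix.transpose_mul]
    congr 3 <;> · push_cast; abel

end Bundle

/-- A smooth connection `∇ = d + θ` on the bundle `E`; the equivariance says that `∇` maps
sections of `E` (functions `s` on `V` with `s (v + l) = e_l(v) s(v)`) to `E`-valued 1-forms. -/
structure Connection {Λ : Submodule ℤ V} {ι : Type} [Fintype ι] [DecidableEq ι]
    (E : Bundle Λ ι) where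
  θ : V → Matrix ι ι W
  smooth : ∀ i j, ContDiff ℝ ∞ fun v => θ v i j
  equivariant : ∀ (l : Λ) (v : V) (i j : ι),
    fderiv ℝ (fun u => E.e l u i j) v + ∑ k, E.e l v k j • θ (v + l) i k
      = ∑ k, E.e l v i k • θ v k j

section ChernWeil

variable {Λ : Submodule ℤ V} {ι κ : Type} [Fintype ι] [DecidableEq ι] [Fintype κ] [DecidableEq κ]

/-- The curvature `dθ + θ ∧ θ`, a matrix of 2-forms. -/
def Connection.curvature {E : Bundle Λ ι} (D : Connection E) (v : V) : Matrix ι ι Form :=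
  (Matrix.of fun i j => extD (fun u => oneForm (D.θ u i j)) v)
    + (D.θ v).map oneForm * (D.θ v).map oneForm

/-- The curvature multiplied by `i / 2π`. -/
def Connection.normCurvature {E : Bundle Λ ι} (D : Connection E) (v : V) : Matrix ι ι Form :=
  (Complex.I / (2 * (Real.pi : ℂ))) • D.curvature v

/-- The Chern form `tr (iF / 2π)`. -/
def Connection.c1Form {E : Bundle Λ ι} (D : Connection E) (v : V) : Form :=
  (D.normCurvature v).trace

/-- The Chern character form `tr exp (iF / 2π)`; terms beyond the fourth power have degree
greater than `8 = dim V` and vanish. -/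
def Connection.chForm {E : Bundle Λ ι} (D : Connection E) (v : V) : Form :=
  ∑ m ∈ Finset.range 5, ((m.factorial : ℂ)⁻¹) • (D.normCurvature v ^ m).trace

/-- `α` is the first Chern class `c₁(E)` in de Rham cohomology. By Chern-Weil theory the class of
the Chern form is the same for all connections. -/
def Bundle.IsFirstChernClass (E : Bundle Λ ι) (α : Form) : Prop :=
  ∃ D : Connection E, Represents Λ D.c1Form α

/-- `α` is the Chern character `ch(E)` in de Rham cohomology. By Chern-Weil theory the class of
the Chern character form is the same for all connections. -/
def Bundle.IsChernCharacter (E : Bundle Λ ι) (α : Form) : Prop :=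
  ∃ D : Connection E, Represents Λ D.chForm α

end ChernWeil

/-- A virtual bundle `pos ⊖ neg`. -/
structure VirtualBundle (Λ : Submodule ℤ V) (ι κ : Type) [Fintype ι] [DecidableEq ι]
    [Fintype κ] [DecidableEq κ] where
  pos : Bundle Λ ι
  neg : Bundle Λ κ

namespace VirtualBundle

variable {Λ : Submodule ℤ V} {ι κ : Type} [Fintype ι] [DecidableEq ι] [Fintype κ] [DecidableEq κ]

/-- The virtual rank. -/
def rank (_ : VirtualBundle Λ ι κ) : ℤ := (Fintype.card ι : ℤ) - (Fintype.card κ : ℤ)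

/-- `α` is the Chern character `ch(pos) - ch(neg)`. -/
def IsChernCharacter (E : VirtualBundle Λ ι κ) (α : Form) : Prop :=
  ∃ α₁ α₂ : Form, E.pos.IsChernCharacter α₁ ∧ E.neg.IsChernCharacter α₂ ∧ α = α₁ - α₂

end VirtualBundle

/-- The first Chern class in terms of the Chern character, `c₁ = ch₁`. -/
def c1OfCh (χ : Form) : Form := degPart 2 χ

/-- The second Chern class in terms of the Chern character, `c₂ = c₁² / 2 - ch₂`. -/
def c2OfCh (χ : Form) : Form := (2⁻¹ : ℂ) • c1OfCh χ ^ 2 - degPart 4 χ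

/-! ### The abelian fourfold -/

/-- `∏_{j < k} (y_j - y_k)`. -/
def vandermonde (y : Fin 4 → ℝ) : ℝ :=
  (y 0 - y 1) * (y 0 - y 2) * (y 0 - y 3) * (y 1 - y 2) * (y 1 - y 3) * (y 2 - y 3)

/-- An irreducible quartic `a X⁴ + b X² + c X + d` over `ℚ` with four real roots
`x 0 > x 1 > x 2 > x 3`, whose splitting field has degree 24 (so that its Galois group is `S₄`)
and for which `Δ = ∏_{j < k} (x j - x k) ^ 2` is an integer. -/
structure Quartic where
  (a b c d : ℚ)
  x : Fin 4 → ℝ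
  Δ : ℕ
  irreducible : Irreducible (Polynomial.C a * Polynomial.X ^ 4 + Polynomial.C b * Polynomial.X ^ 2
    + Polynomial.C c * Polynomial.X + Polynomial.C d)
  isRoot : ∀ j, (a : ℝ) * x j ^ 4 + (b : ℝ) * x j ^ 2 + (c : ℝ) * x j + (d : ℝ) = 0
  strictAnti : StrictAnti x
  finrank_splitting : Module.finrank ℚ (IntermediateField.adjoin ℚ (Set.range x)) = 24
  Δ_eq : (Δ : ℝ) = vandermonde x ^ 2

namespace Quartic

variable (P : Quartic)

/-- `𝔻 = ∏_{j < k} (x j - x k) = √Δ > 0`. -/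
def 𝔻 : ℝ := vandermonde P.x

/-- The field `F = ℚ(x 0, i𝔻)`. It is the fixed field of the stabiliser of a vertex, for the
action of `S₄ × {1, ρ}` on the vertices of the cube, inside the splitting field of the quartic
with `i` adjoined. -/
def F : IntermediateField ℚ ℂ :=
  IntermediateField.adjoin ℚ {(P.x 0 : ℂ), Complex.I * (P.𝔻 : ℂ)}

/-- The generator `x 0` of `F`. -/
def xGen : P.F := ⟨(P.x 0 : ℂ), IntermediateField.subset_adjoin _ _ (by simp)⟩

/-- The generator `i𝔻` of `F`. -/
def iDGen : P.F := ⟨Complex.I * (P.𝔻 : ℂ), IntermediateField.subset_adjoin _ _ (by simp)⟩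

theorem isIntegral_xGen : IsIntegral ℚ (P.x 0 : ℂ) := by
  rw [← isAlgebraic_iff_isIntegral]
  refine ⟨_, P.irreducible.ne_zero, ?_⟩
  have h := congrArg (fun r : ℝ => (r : ℂ)) (P.isRoot 0)
  simpa using h

theorem iD_sq : (Complex.I * (P.𝔻 : ℂ)) ^ 2 = -(P.Δ : ℂ) := by
  have h := congrArg (fun r : ℝ => (r : ℂ)) P.Δ_eq
  simp only [Complex.ofReal_natCast, Complex.ofReal_pow] at h
  rw [mul_pow, Complex.I_sq, h, 𝔻]
  ring

theorem isIntegral_iDGen : IsIntegral ℚ (Complex.I * (P.𝔻 : ℂ)) := by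
  refine IsIntegral.of_pow (n := 2) (by norm_num) ?_
  rw [iD_sq]
  simpa using isIntegral_algebraMap (R := ℚ) (A := ℂ) (x := -(P.Δ : ℚ))

/-- The embeddings `φ_j` exist. -/
theorem exists_embedding (j : Fin 4) : ∃ φ : P.F →ₐ[ℚ] ℂ,
    φ P.xGen = (P.x j : ℂ) ∧ φ P.iDGen = (-1) ^ (j : ℕ) * (Complex.I * (P.𝔻 : ℂ)) := by
  have hroot : ∀ i, Polynomial.aeval (P.x i : ℂ) (minpoly ℚ (P.x 0 : ℂ)) = 0 := by
    intro i
    have h0 := congrArg (fun r : ℝ => (r : ℂ)) (P.isRoot 0)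
    have hi := congrArg (fun r : ℝ => (r : ℂ)) (P.isRoot i)
    rw [← minpoly.eq_of_irreducible (x := (P.x 0 : ℂ)) P.irreducible (by simpa using h0),
      map_mul]
    refine mul_eq_zero_of_left ?_ _
    simpa using hi
  obtain ⟨ψ, hψ⟩ := IntermediateField.exists_algHom_adjoin_of_splits_of_aeval
    (F := ℚ) (E := ℂ) (K := ℂ) (S := {(P.x 0 : ℂ), Complex.I * (P.𝔻 : ℂ)})
    (fun s hs => by
      refine ⟨?_, IsAlgClosed.splits _⟩
      rcases hs with rfl | rfl
      · exact P.isIntegral_xGen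
      · exact P.isIntegral_iDGen)
    P.xGen.2 (hroot j)
  change P.F →ₐ[ℚ] ℂ at ψ
  have hx : ψ P.xGen = (P.x j : ℂ) := hψ
  have hsq : ψ P.iDGen ^ 2 = (Complex.I * (P.𝔻 : ℂ)) ^ 2 := by
    have h : P.iDGen ^ 2 = -((P.Δ : ℕ) : P.F) := by
      apply Subtype.ext
      simpa [iDGen] using P.iD_sq
    rw [← map_pow, h, iD_sq]
    simp
  have key : ∀ t : ℂ, t ^ 2 = 1 → ∃ φ : P.F →ₐ[ℚ] ℂ,
      φ P.xGen = (P.x j : ℂ) ∧ φ P.iDGen = t * (Complex.I * (P.𝔻 : ℂ)) := by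
    intro t ht
    let conj : ℂ →ₐ[ℚ] ℂ := (Complex.conjAe : ℂ →ₐ[ℝ] ℂ).restrictScalars ℚ
    have hc : ∀ z : ℂ, conj z = (starRingEnd ℂ) z := fun z => rfl
    rcases sq_eq_sq_iff_eq_or_eq_neg.mp (ht.trans (one_pow 2).symm) with rfl | rfl <;>
    rcases sq_eq_sq_iff_eq_or_eq_neg.mp hsq with h | h
    · exact ⟨ψ, hx, by rw [h, one_mul]⟩
    · exact ⟨conj.comp ψ, by simp [hc, hx], by simp [hc, h]⟩
    · exact ⟨conj.comp ψ, by simp [hc, hx], by simp [hc, h]⟩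
    · exact ⟨ψ, hx, by rw [h, neg_one_mul]⟩
  exact key _ (by rw [← pow_mul, mul_comm, pow_mul]; simp)

/-- The embedding `φ_j : F → ℂ`, determined by `x 0 ↦ x j` and `i𝔻 ↦ (-1)^j i𝔻`
(`j = 0, 1, 2, 3`). The other four embeddings are the complex conjugates. -/
def φ (j : Fin 4) : P.F →ₐ[ℚ] ℂ := (P.exists_embedding j).choose

/-- The map `F → ℂ⁴` with components `φ_j`. -/
def zMap : P.F →+* V := RingHom.pi fun j => (P.φ j).toRingHom

/-- The lattice `Λ ⊂ V`, the image of the ring of integers of `F`; the abelian fourfold is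
`X = V / Λ`. -/
def lattice : Submodule ℤ V :=
  LinearMap.range (P.zMap.comp
    (algebraMap (NumberField.RingOfIntegers P.F) P.F)).toAddMonoidHom.toIntLinearMap

/-- The form `dz_φ` for the embedding `φ` of `F` with `x 0 ↦ x j` and `i𝔻 ↦ s i𝔻`, that is `dz_j`
or `d\bar z_j`. -/
def dzVertex (j : Fin 4) (s : ℤˣ) : Form :=
  if s = (-1) ^ (j : ℕ) then dz j else dzbar j

/-- `1/4` of the sum of `coeff g dz_{gφ} ∧ dz_{gφ'}` over the Galois group
`S₄ × {1, ρ}`, where `φ = φ_0`, `φ' = φ_2`. The element `g = (σ, ε)` acts by `x j ↦ x (σ j)` and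
`i ↦ ε i`, hence by `i𝔻 ↦ ε sign(σ) i𝔻`. Each of the twelve terms of the orbit of the unordered
pair `{φ_0, φ_2}` occurs four times in the sum over the group. -/
def galoisForm (coeff : Equiv.Perm (Fin 4) → ℤˣ → ℂ) : Form :=
  (4⁻¹ : ℂ) • ∑ σ : Equiv.Perm (Fin 4), ∑ ε : ℤˣ,
    coeff σ ε • (dzVertex (σ 0) (Equiv.Perm.sign σ * ε) * dzVertex (σ 2) (Equiv.Perm.sign σ * ε))

/-- `(y₀ y₂ + y₁ y₃)(y₀ - y₂)`, the coefficient of `dz_0 ∧ dz_2` in `A₁` at `y = x`. -/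
def coeff02 (y : Fin 4 → ℝ) : ℝ := (y 0 * y 2 + y 1 * y 3) * (y 0 - y 2)

/-- The class `A₁ = h (x_0 - x_2) dz_0 dz_2 + …` with `h = x_0 x_2 + x_1 x_3`, the other terms
being determined by Galois covariance. -/
def A₁ : Form := galoisForm fun σ _ => (coeff02 (P.x ∘ σ) : ℂ)

/-- The class `A₂ = (i c 𝔻) h (x_0 - x_2) dz_0 dz_2 + …`, the other terms being determined by
Galois covariance. -/
def A₂ (c : ℤ) : Form :=
  galoisForm fun σ ε =>
    (((ε : ℤ) : ℂ) * Complex.I) * (c : ℂ) * (vandermonde (P.x ∘ σ) : ℂ) * (coeff02 (P.x ∘ σ) : ℂ)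

/-- The class `M = 𝔻 (dz_0 d\bar z_1 dz_2 d\bar z_3 + d\bar z_0 dz_1 d\bar z_2 dz_3)`. -/
def M : Form :=
  (P.𝔻 : ℂ) • (dz 0 * dzbar 1 * dz 2 * dzbar 3 + dzbar 0 * dz 1 * dzbar 2 * dz 3)

/-- `μ_j = ∏_{l ≠ j} (x j - x l)`. -/
def μ (j : Fin 4) : ℝ := ∏ l ∈ Finset.univ.erase j, (P.x j - P.x l)

/-- The Kähler form `ω = (i𝔻 / Δ) ∑_j (-1)^j μ_j dz_j d\bar z_j` (`j = 0, 1, 2, 3`). -/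
def omegaForm : Form :=
  (Complex.I * (P.𝔻 : ℂ) / (P.Δ : ℂ)) •
    ∑ j : Fin 4, ((-1 : ℂ) ^ (j : ℕ) * (P.μ j : ℂ)) • (dz j * dzbar j)

/-- The virtual bundle
`(L₁ ⊗ K ⊕ L₁⁻¹ ⊗ K)^n ⊖ (L₂ ⊕ L₂⁻¹)`. -/
def virtualE {Λ : Submodule ℤ V} (L₁ L₂ K : LineBundle Λ) (n : ℕ) :
    VirtualBundle Λ ((Unit × Unit ⊕ Unit × Unit) × Fin n) (Unit ⊕ Unit) where
  pos := ((L₁.tensor K).sum (L₁.dual.tensor K)).copies n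
  neg := L₂.sum L₂.dual

end Quartic

end

end AbelianFourfold

namespace AbelianFourfold

noncomputable section

/-! ### Exterior algebra -/

/-! An embedding of `F` is a pair (root x_j, sign of i𝔻): a vertex of a cube in which antipodes are
complex conjugate. Vertices of equal sign form two inscribed tetrahedra, with covectors `evenFun`
(z_0, \bar z_1, z_2, \bar z_3) and `oddFun` (their conjugates). The orbit of {φ_0, φ_2} consists of
the twelve edges of the tetrahedra. Hence A₁ = α + β and A₂ = ic𝔻(α - β), where α and β have the
same coefficients h_{jl} in the even and in the odd covectors, while ω lives on the four long
diagonals.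

Put n = c²Δ, so (ic𝔻)² = -n. Odd powers of A₁ and A₂ cancel between a line bundle and its inverse,
and in degree 4 the Chern character is n(α + β)² + n(α - β)² + nk²ω² = 2n(α² + β²) + nk²ω²: the
second bundle serves to remove αβ. The square α² is twice a Pfaffian times the product of the even
covectors; the Pfaffian is 𝔻 (`pfaffian_eq`), so α² + β² = 2M.

In degree 6 only ω³ and A₁²ω occur. A product of all four even, or all four odd, covectors kills ω,
so Mω = 0 and A₁²ω = 2αβω. The identities `orthogonality` cancel every term of αβω except products
of three pairs even_j ∧ odd_j, each of type (1,1).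

Rationality comes from the functionals u ↦ Tr(x^p u) and u ↦ Tr(i𝔻 x^p u): the coefficients of α, β
and ω are polynomials over ℚ in two roots, for ω because the divided difference of the quartic
vanishes at two distinct roots and is proportional to μ_j on the diagonal.

Since Mω = 0, only ω⁴ enters the Bogomolov expression, and arithmetic gives the factor n/(n - 1).
Positivity of ⟨ω⁴⟩ follows from ∏ μ_j = 𝔻² and the full rank of the lattice. Finally n ≥ 2: if Δ =
1, then 𝔻 = 1 and every embedding of the splitting field permutes the roots evenly, so its degree is
at most 12.

On the bundle side, Chern-Weil theory is needed only for diagonal connections, where ch is a sum of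
exponentials; `Represents.mul` carries powers over to cohomology. -/

theorem oneForm_mul (f : W) (x : Form) :
    oneForm f * x = CliffordAlgebra.involute x * oneForm f := by
  induction x using ExteriorAlgebra.induction with
  | algebraMap r =>
    rw [show CliffordAlgebra.involute (algebraMap ℂ Form r) = algebraMap ℂ Form r from
      AlgHom.commutes _ _]
    exact (Algebra.commutes r _).symm
  | ι g =>
    rw [show CliffordAlgebra.involute (ExteriorAlgebra.ι ℂ g) = -ExteriorAlgebra.ι ℂ g from
      CliffordAlgebra.involute_ι g]
    rw [neg_mul]
    exact eq_neg_of_add_eq_zero_left (ExteriorAlgebra.ι_add_mul_swap f g)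
  | mul a b ha hb =>
    rw [← mul_assoc, ha, mul_assoc, hb, map_mul, mul_assoc]
  | add a b ha hb => rw [mul_add, ha, hb, map_add, add_mul]

theorem oneForm_sq (f : W) : oneForm f * oneForm f = 0 := ExteriorAlgebra.ι_sq_zero f

theorem oneForm_swap (f g : W) : oneForm g * oneForm f = -(oneForm f * oneForm g) :=
  eq_neg_of_add_eq_zero_left (ExteriorAlgebra.ι_add_mul_swap g f)

/-- Passing two covectors across x applies the grade involution twice. Centrality of 2-forms lets
the later identities be proved in a commutative ring. -/
theorem two_mem_center (f g : W) : oneForm f * oneForm g ∈ Subalgebra.center ℂ Form := by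
  rw [Subalgebra.mem_center_iff]
  intro x
  calc x * (oneForm f * oneForm g) = x * oneForm f * oneForm g := (mul_assoc _ _ _).symm
    _ = oneForm f * CliffordAlgebra.involute x * oneForm g := by
      rw [oneForm_mul f, CliffordAlgebra.involute_involute]
    _ = oneForm f * oneForm g * x := by rw [mul_assoc, ← oneForm_mul, mul_assoc]

/-! ### The exterior derivative -/

instance finiteDimensional_form : FiniteDimensional ℂ Form :=
  Module.Finite.equiv formCoord.symm

instance finiteDimensional_real_form : FiniteDimensional ℝ Form :=
  FiniteDimensional.complexToReal Form

/-- The wedge product as a continuous bilinear map. -/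
def wedgeL : Form →L[ℝ] Form →L[ℝ] Form :=
  LinearMap.toContinuousBilinearMap (LinearMap.mk₂ ℝ (fun a b : Form => a * b)
    add_mul (fun r a b => smul_mul_assoc (r : ℂ) a b) mul_add
    (fun r a b => mul_smul_comm (r : ℂ) a b))

theorem wedgeL_apply (a b : Form) : wedgeL a b = a * b := rfl

/-- `oneForm` as a continuous linear map. -/
def oneFormL : W →L[ℝ] Form :=
  haveI : FiniteDimensional ℝ W := FiniteDimensional.complexToReal W
  LinearMap.toContinuousLinearMap ((ExteriorAlgebra.ι ℂ (M := W)).restrictScalars ℝ)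

/-- The differentials of the real coordinates. -/
def coordForm (k : Fin 4 ⊕ Fin 4) : W := Sum.elim xFun yFun k

/-- The coordinate directions. -/
def coordVec (k : Fin 4 ⊕ Fin 4) : V :=
  Sum.elim (fun j => Pi.single j 1) (fun j => Pi.single j Complex.I) k

theorem extD_eq (η : V → Form) (v : V) :
    extD η v = ∑ k, oneForm (coordForm k) * fderiv ℝ η v (coordVec k) := by
  simp [extD, coordForm, coordVec, Finset.sum_add_distrib]

theorem extD_add {β γ : V → Form} (hβ : ContDiff ℝ ∞ β) (hγ : ContDiff ℝ ∞ γ) (v : V) :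
    extD (fun u => β u + γ u) v = extD β v + extD γ v := by
  simp only [extD_eq]
  rw [fderiv_fun_add (hβ.differentiable (by simp) v) (hγ.differentiable (by simp) v)]
  simp [mul_add, Finset.sum_add_distrib]

theorem extD_smul {β : V → Form} (hβ : ContDiff ℝ ∞ β) (c : ℂ) (v : V) :
    extD (fun u => c • β u) v = c • extD β v := by
  simp only [extD_eq]
  rw [fderiv_fun_const_smul (hβ.differentiable (by simp) v)]
  simp [Finset.smul_sum]

theorem extD_const (a : Form) (v : V) : extD (fun _ => a) v = 0 := by
  simp [extD_eq]

theorem contDiff_wedge {β γ : V → Form} (hβ : ContDiff ℝ ∞ β) (hγ : ContDiff ℝ ∞ γ) :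
    ContDiff ℝ ∞ fun u => β u * γ u :=
  (wedgeL.isBoundedBilinearMap.contDiff).comp₂ hβ hγ

/-- The graded Leibniz rule; the grade involution replaces the sign (-1)^deg, so no homogeneity is
needed. -/
theorem extD_mul {β γ : V → Form} (hβ : ContDiff ℝ ∞ β) (hγ : ContDiff ℝ ∞ γ) (v : V) :
    extD (fun u => β u * γ u) v
      = extD β v * γ v + CliffordAlgebra.involute (β v) * extD γ v := by
  have h : ∀ w, fderiv ℝ (fun u => β u * γ u) v w
      = β v * fderiv ℝ γ v w + fderiv ℝ β v w * γ v := by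
    intro w
    have := wedgeL.fderiv_of_bilinear (hβ.differentiable (by simp) v)
      (hγ.differentiable (by simp) v)
    simp only [wedgeL_apply] at this
    rw [this]
    rfl
  simp only [extD_eq, h, mul_add, Finset.sum_add_distrib, Finset.sum_mul, Finset.mul_sum]
  rw [add_comm]
  congr 1
  · simp only [mul_assoc]
  · refine Finset.sum_congr rfl fun k _ => ?_
    rw [← mul_assoc, oneForm_mul, mul_assoc]

theorem contDiff_extD {β : V → Form} (hβ : ContDiff ℝ ∞ β) : ContDiff ℝ ∞ (extD β) := by
  have : extD β = fun v => ∑ k, oneForm (coordForm k) * fderiv ℝ β v (coordVec k) :=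
    funext (extD_eq β)
  rw [this]
  refine ContDiff.sum fun k _ => contDiff_wedge contDiff_const ?_
  exact (hβ.fderiv_right (m := ∞) (by simp)).clm_apply contDiff_const

theorem extD_extD {β : V → Form} (hβ : ContDiff ℝ ∞ β) (v : V) : extD (extD β) v = 0 := by
  have hd : ContDiff ℝ ∞ (fderiv ℝ β) := hβ.fderiv_right (m := ∞) (by simp)
  have h1 : ∀ w, fderiv ℝ (extD β) v w
      = ∑ k, oneForm (coordForm k) * fderiv ℝ (fderiv ℝ β) v w (coordVec k) := by
    intro w
    have : extD β = fun v => ∑ k, wedgeL (oneForm (coordForm k)) (fderiv ℝ β v (coordVec k)) :=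
      funext (extD_eq β)
    rw [this]
    have hk : ∀ k : Fin 4 ⊕ Fin 4, HasFDerivAt
        (fun v => wedgeL (oneForm (coordForm k)) (fderiv ℝ β v (coordVec k)))
        ((wedgeL (oneForm (coordForm k))).comp
          ((ContinuousLinearMap.apply ℝ Form (coordVec k)).comp (fderiv ℝ (fderiv ℝ β) v))) v := by
      intro k
      refine (wedgeL (oneForm (coordForm k))).hasFDerivAt.comp v ?_
      exact (ContinuousLinearMap.apply ℝ Form (coordVec k)).hasFDerivAt.comp v
        (hd.differentiable (by simp) v).hasFDerivAt
    rw [(HasFDerivAt.fun_sum fun k _ => hk k).fderiv]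
    simp [wedgeL_apply]
  have hsymm : ∀ a b, fderiv ℝ (fderiv ℝ β) v a b = fderiv ℝ (fderiv ℝ β) v b a := by
    have : IsSymmSndFDerivAt ℝ β v :=
      (hβ.contDiffAt).isSymmSndFDerivAt (n := ∞)
      (by simpa using WithTop.coe_le_coe.mpr (le_top : (2 : ℕ∞) ≤ ⊤))
    exact fun a b => this a b
  rw [extD_eq]
  simp only [h1, Finset.mul_sum, ← mul_assoc]
  set S := ∑ i, ∑ k, oneForm (coordForm i) * oneForm (coordForm k)
    * fderiv ℝ (fderiv ℝ β) v (coordVec i) (coordVec k) with hS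
  -- Exchanging the two indices keeps the second derivative, by symmetry, and changes the sign of
  -- the product of covectors.
  have : S = -S := by
    conv_lhs => rw [hS, Finset.sum_comm]
    rw [hS, ← Finset.sum_neg_distrib]
    refine Finset.sum_congr rfl fun i _ => ?_
    rw [← Finset.sum_neg_distrib]
    refine Finset.sum_congr rfl fun k _ => ?_
    rw [oneForm_swap, hsymm, neg_mul]
  have h2 : (2 : ℂ) • S = 0 := by
    rw [two_smul]; nth_rewrite 1 [this]; simp
  simpa using h2

theorem extD_periodic {Λ : Submodule ℤ V} {β : V → Form}
    (hp : ∀ l ∈ Λ, ∀ v, β (v + l) = β v) : ∀ l ∈ Λ, ∀ v, extD β (v + l) = extD β v := by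
  intro l hl v
  have h : fderiv ℝ β (v + l) = fderiv ℝ β v := by
    rw [← fderiv_comp_add_right, funext (hp l hl)]
  simp only [extD, h]

/-! ### Cohomologous forms -/

section Represents

variable {Λ : Submodule ℤ V} {η η' : V → Form} {α α' : Form}

theorem Represents.contDiff (h : Represents Λ η α) : ContDiff ℝ ∞ η := by
  obtain ⟨β, hβ, -, he⟩ := h
  rw [show η = fun v => α + extD β v from funext he]
  exact contDiff_const.add (contDiff_extD hβ)

theorem Represents.closed (h : Represents Λ η α) (v : V) : extD η v = 0 := by
  obtain ⟨β, hβ, -, he⟩ := h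
  rw [show η = fun v => α + extD β v from funext he, extD_add contDiff_const (contDiff_extD hβ),
    extD_const, zero_add]
  exact extD_extD hβ v

theorem Represents.const (α : Form) : Represents Λ (fun _ => α) α :=
  ⟨fun _ => 0, contDiff_const, fun _ _ _ => rfl, fun v => by rw [extD_const, add_zero]⟩

theorem Represents.add (h : Represents Λ η α) (h' : Represents Λ η' α') :
    Represents Λ (fun v => η v + η' v) (α + α') := by
  obtain ⟨β, hβ, hp, he⟩ := h
  obtain ⟨β', hβ', hp', he'⟩ := h'
  refine ⟨fun v => β v + β' v, hβ.add hβ',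
    fun l hl v => by simp only [hp l hl, hp' l hl], fun v => ?_⟩
  simp only [extD_add hβ hβ', he, he']
  abel

theorem Represents.smul (c : ℂ) (h : Represents Λ η α) :
    Represents Λ (fun v => c • η v) (c • α) := by
  obtain ⟨β, hβ, hp, he⟩ := h
  refine ⟨fun v => c • β v, hβ.const_smul c, fun l hl v => by simp only [hp l hl], fun v => ?_⟩
  simp only [extD_smul hβ, he, smul_add]

theorem Represents.mul (h : Represents Λ η α) (h' : Represents Λ η' α') :
    Represents Λ (fun v => η v * η' v) (α * α') := by
  have hη' := h'.contDiff
  have hc' := h'.closed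
  obtain ⟨β, hβ, hp, he⟩ := h
  have h'' := h'
  obtain ⟨β', hβ', hp', he'⟩ := h''
  have hper : ∀ l ∈ Λ, ∀ v, η' (v + l) = η' v := fun l hl v => by
    rw [he', he', extD_periodic hp' l hl]
  have c1 : ContDiff ℝ ∞ fun v => β v * η' v := contDiff_wedge hβ hη'
  have c2 : ContDiff ℝ ∞ fun v => CliffordAlgebra.involute α * β' v :=
    contDiff_wedge contDiff_const hβ'
  -- From ηη' - αα' = dβ ∧ η' + α ∧ dβ'. The first term is d(β ∧ η') because η' is closed; the
  -- involution on α cancels the one in the Leibniz rule.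
  refine ⟨fun v => β v * η' v + CliffordAlgebra.involute α * β' v, c1.add c2,
    fun l hl v => by simp only [hp l hl, hp' l hl, hper l hl], fun v => ?_⟩
  rw [extD_add c1 c2, extD_mul hβ hη', hc', mul_zero, add_zero, extD_mul contDiff_const hβ',
    extD_const, zero_mul, zero_add, CliffordAlgebra.involute_involute]
  change η v * η' v = _
  rw [he v, he' v]
  noncomm_ring

theorem Represents.pow (h : Represents Λ η α) (m : ℕ) :
    Represents Λ (fun v => η v ^ m) (α ^ m) := by
  induction m with
  | zero => simpa using Represents.const (Λ := Λ) (1 : Form)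
  | succ m ih => simpa only [pow_succ] using ih.mul h

theorem Represents.sum {ι : Type*} (s : Finset ι) {η : ι → V → Form} {α : ι → Form}
    (h : ∀ i ∈ s, Represents Λ (η i) (α i)) :
    Represents Λ (fun v => ∑ i ∈ s, η i v) (∑ i ∈ s, α i) := by
  classical
  induction s using Finset.induction_on with
  | empty => simpa using Represents.const (Λ := Λ) (0 : Form)
  | insert i s hi ih =>
    simp only [Finset.sum_insert hi]
    exact (h i (Finset.mem_insert_self i s)).add
      (ih fun j hj => h j (Finset.mem_insert_of_mem hj))

/-- The exponential series, truncated after the fourth power. -/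
def expForm (α : Form) : Form := ∑ m ∈ Finset.range 5, ((m.factorial : ℂ)⁻¹) • α ^ m

theorem Represents.expForm (h : Represents Λ η α) :
    Represents Λ (fun v => expForm (η v)) (expForm α) :=
  Represents.sum _ fun m _ => (h.pow m).smul _

end Represents

/-! ### Bundles with diagonal factors of automorphy -/

section Diagonal

variable {Λ : Submodule ℤ V} {ι : Type} [Fintype ι] [DecidableEq ι]

theorem sum_diagonal_smul {M : Type*} [AddCommMonoid M] [Module ℂ M] (d : ι → ℂ) (t : ι → M)
    (i j : ι) : ∑ k, Matrix.diagonal d k j • Matrix.diagonal t i k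
      = if i = j then d i • t i else 0 := by
  simp [Matrix.diagonal_apply, eq_comm]

theorem sum_diagonal_smul' {M : Type*} [AddCommMonoid M] [Module ℂ M] (d : ι → ℂ) (t : ι → M)
    (i j : ι) : ∑ k, Matrix.diagonal d i k • Matrix.diagonal t k j
      = if i = j then d i • t i else 0 := by
  by_cases h : i = j
  · subst h; simp [Matrix.diagonal_apply]
  · simp [Matrix.diagonal_apply, h]

/-- A connection on a bundle whose factor of automorphy is diagonal. -/
def diagConnection (E : Bundle Λ ι) (d : ι → Λ → V → ℂ) (θ : ι → V → W)
    (he : ∀ l v, E.e l v = Matrix.diagonal fun i => d i l v)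
    (hθ : ∀ i, ContDiff ℝ ∞ (θ i))
    (heq : ∀ i l v, fderiv ℝ (d i l) v + d i l v • θ i (v + l) = d i l v • θ i v) :
    Connection E where
  θ v := Matrix.diagonal fun i => θ i v
  smooth i j := by
    by_cases h : i = j
    · subst h; simpa using hθ i
    · simpa [Matrix.diagonal_apply_ne _ h] using contDiff_const
  equivariant l v i j := by
    simp only [he]
    refine (congrArg₂ (· + ·) rfl (sum_diagonal_smul _ _ i j)).trans
      (Eq.trans ?_ (sum_diagonal_smul' _ _ i j).symm)
    by_cases h : i = j
    · subst h
      simpa using heq i l v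
    · simp [h]

/-- The Chern form of the line bundle connection `d + θ`. -/
def lineChernForm (θ : V → W) (v : V) : Form :=
  (Complex.I / (2 * (Real.pi : ℂ))) • extD (fun u => oneForm (θ u)) v

/-- For a diagonal connection θ ∧ θ is diagonal with entries θ_i ∧ θ_i = 0, so the curvature is dθ
entry by entry. -/
theorem diagConnection_normCurvature (E : Bundle Λ ι) (d : ι → Λ → V → ℂ) (θ : ι → V → W)
    (he : ∀ l v, E.e l v = Matrix.diagonal fun i => d i l v)
    (hθ : ∀ i, ContDiff ℝ ∞ (θ i))
    (heq : ∀ i l v, fderiv ℝ (d i l) v + d i l v • θ i (v + l) = d i l v • θ i v) (v : V) :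
    (diagConnection E d θ he hθ heq).normCurvature v
      = Matrix.diagonal fun i => lineChernForm (θ i) v := by
  have h0 : oneForm (0 : W) = 0 := map_zero _
  rw [Connection.normCurvature, Connection.curvature]
  have h1 : (Matrix.of fun i j => extD
      (fun u => oneForm ((diagConnection E d θ he hθ heq).θ u i j)) v)
      = Matrix.diagonal fun i => extD (fun u => oneForm (θ i u)) v := by
    ext i j
    by_cases h : i = j
    · subst h; simp [diagConnection]
    · simp [diagConnection, Matrix.diagonal_apply_ne _ h, extD_const]
  have h2 : ((diagConnection E d θ he hθ heq).θ v).map oneForm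
      = Matrix.diagonal fun i => oneForm (θ i v) := by
    ext i j
    by_cases h : i = j
    · subst h; simp [diagConnection]
    · simp [diagConnection, Matrix.diagonal_apply_ne _ h]
  rw [h1, h2, Matrix.diagonal_mul_diagonal]
  simp only [oneForm_sq, Matrix.diagonal_zero, add_zero]
  ext i j
  by_cases h : i = j
  · subst h; simp [lineChernForm]
  · simp [Matrix.diagonal_apply_ne _ h]

theorem isChernCharacter_of_diagonal (E : Bundle Λ ι) (d : ι → Λ → V → ℂ) (θ : ι → V → W)
    (he : ∀ l v, E.e l v = Matrix.diagonal fun i => d i l v)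
    (hθ : ∀ i, ContDiff ℝ ∞ (θ i))
    (heq : ∀ i l v, fderiv ℝ (d i l) v + d i l v • θ i (v + l) = d i l v • θ i v)
    (α : ι → Form) (hα : ∀ i, Represents Λ (lineChernForm (θ i)) (α i)) :
    E.IsChernCharacter (∑ i, expForm (α i)) := by
  refine ⟨diagConnection E d θ he hθ heq, ?_⟩
  have h : (diagConnection E d θ he hθ heq).chForm
      = fun v => ∑ i, expForm (lineChernForm (θ i) v) := by
    funext v
    simp only [Connection.chForm, diagConnection_normCurvature, Matrix.diagonal_pow,
      Matrix.trace_diagonal, expForm, Finset.smul_sum, Pi.pow_apply]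
    exact Finset.sum_comm
  rw [h]
  exact Represents.sum _ fun i _ => (hα i).expForm

end Diagonal

/-! ### Connections on line bundles, their tensor products and duals -/

section Line

variable {Λ : Submodule ℤ V}

/-- `θ` is the connection form of a smooth connection on the line bundle with factor of
automorphy `d`. -/
def IsLineConnection (d : Λ → V → ℂ) (θ : V → W) : Prop :=
  ContDiff ℝ ∞ θ ∧ ∀ l v, fderiv ℝ (d l) v + d l v • θ (v + l) = d l v • θ v

theorem contDiff_oneForm {θ : V → W} (h : ContDiff ℝ ∞ θ) :
    ContDiff ℝ ∞ fun u => oneForm (θ u) :=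
  oneFormL.contDiff.comp h

theorem Bundle.IsFirstChernClass.exists_lineConnection {L : LineBundle Λ} {α : Form}
    (h : L.IsFirstChernClass α) :
    ∃ θ : V → W, IsLineConnection (fun l v => L.e l v () ()) θ ∧
      Represents Λ (lineChernForm θ) α := by
  obtain ⟨D, hD⟩ := h
  refine ⟨fun v => D.θ v () (), ⟨D.smooth () (), fun l v => ?_⟩, ?_⟩
  · simpa using D.equivariant l v () ()
  · have : D.c1Form = lineChernForm (fun v => D.θ v () ()) := by
      funext v
      simp [Connection.c1Form, Connection.normCurvature, Connection.curvature, Matrix.trace,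
        Matrix.mul_apply, lineChernForm]
    rwa [this] at hD

theorem lineChernForm_add {θ θ' : V → W} (h : ContDiff ℝ ∞ θ) (h' : ContDiff ℝ ∞ θ') :
    lineChernForm (fun v => θ v + θ' v) = fun v => lineChernForm θ v + lineChernForm θ' v := by
  funext v
  simp only [lineChernForm, oneForm, map_add]
  rw [extD_add (contDiff_oneForm h) (contDiff_oneForm h'), smul_add]

theorem lineChernForm_neg {θ : V → W} (h : ContDiff ℝ ∞ θ) :
    lineChernForm (fun v => -θ v) = fun v => (-1 : ℂ) • lineChernForm θ v := by
  funext v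
  have : (fun u => oneForm (-θ u)) = fun u => (-1 : ℂ) • oneForm (θ u) := by
    funext u; simp [oneForm]
  simp only [lineChernForm]
  rw [this, extD_smul (contDiff_oneForm h), smul_comm]

theorem IsLineConnection.tensor {L L' : LineBundle Λ} {θ θ' : V → W}
    (h : IsLineConnection (fun l v => L.e l v () ()) θ)
    (h' : IsLineConnection (fun l v => L'.e l v () ()) θ') :
    IsLineConnection (fun l v => (L.tensor L').e l v ((), ()) ((), ()))
      (fun v => θ v + θ' v) := by
  refine ⟨h.1.add h'.1, fun l v => ?_⟩
  have d1 := (L.smooth l () ()).differentiable (by simp) v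
  have d2 := (L'.smooth l () ()).differentiable (by simp) v
  have e1 := h.2 l v
  have e2 := h'.2 l v
  simp only [Bundle.tensor, Matrix.kroneckerMap_apply]
  rw [fderiv_fun_mul d1 d2]
  rw [← eq_sub_iff_add_eq] at e1 e2
  rw [e1, e2]
  module

theorem IsLineConnection.dual {L : LineBundle Λ} {θ : V → W}
    (h : IsLineConnection (fun l v => L.e l v () ()) θ) :
    IsLineConnection (fun l v => L.dual.e l v () ()) (fun v => -θ v) := by
  refine ⟨h.1.neg, fun l v => ?_⟩
  -- The dual has factor e_{-l}(v + l), so the equivariance of θ is taken for -l at the point v + l.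
  have e1 := h.2 (-l) (v + l)
  have hv : v + (l : V) + ((-l : Λ) : V) = v := by push_cast; abel
  rw [hv] at e1
  simp only [Bundle.dual, Matrix.transpose_apply]
  have : fderiv ℝ (fun u : V => L.e (-l) (u + l) () ()) v
      = fderiv ℝ (fun u : V => L.e (-l) u () ()) (v + l) :=
    fderiv_comp_add_right (f := fun u : V => L.e (-l) u () ()) (x := v) (l : V)
  rw [this, eq_sub_of_add_eq e1]
  module

end Line

/-! ### Chern character of the virtual bundle as a sum of exponentials -/

theorem virtualE_isChernCharacter {Λ : Submodule ℤ V} {L₁ L₂ K : LineBundle Λ} {a₁ a₂ w : Form}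
    (h₁ : L₁.IsFirstChernClass a₁) (h₂ : L₂.IsFirstChernClass a₂) (hK : K.IsFirstChernClass w)
    (n : ℕ) : (Quartic.virtualE L₁ L₂ K n).IsChernCharacter
      ((n : ℂ) • (expForm (a₁ + w) + expForm (-a₁ + w)) - (expForm a₂ + expForm (-a₂))) := by
  obtain ⟨θ₁, c₁, r₁⟩ := h₁.exists_lineConnection
  obtain ⟨θ₂, c₂, r₂⟩ := h₂.exists_lineConnection
  obtain ⟨θ, cK, rK⟩ := hK.exists_lineConnection
  have r₁' : Represents Λ (lineChernForm fun v => -θ₁ v) (-a₁) := by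
    rw [lineChernForm_neg c₁.1]; simpa using r₁.smul (-1)
  have r₂' : Represents Λ (lineChernForm fun v => -θ₂ v) (-a₂) := by
    rw [lineChernForm_neg c₂.1]; simpa using r₂.smul (-1)
  have t := c₁.tensor cK
  have t' := c₁.dual.tensor cK
  have d₂ := c₂.dual
  refine ⟨_, _, ?_, ?_, rfl⟩
  · have := isChernCharacter_of_diagonal (Quartic.virtualE L₁ L₂ K n).pos
      (fun i l v => Sum.elim (fun _ => (L₁.tensor K).e l v ((), ()) ((), ()))
        (fun _ => (L₁.dual.tensor K).e l v ((), ()) ((), ())) i.1)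
      (fun i v => Sum.elim (fun _ => θ₁ v + θ v) (fun _ => -θ₁ v + θ v) i.1)
      (fun l v => by
        ext ⟨i, p⟩ ⟨j, q⟩
        rcases i with ⟨⟨⟩, ⟨⟩⟩ | ⟨⟨⟩, ⟨⟩⟩ <;> rcases j with ⟨⟨⟩, ⟨⟩⟩ | ⟨⟨⟩, ⟨⟩⟩ <;>
        by_cases h : p = q <;>
        simp [Quartic.virtualE, Bundle.copies, Bundle.sum, Matrix.blockDiagonal_apply, h])
      (by rintro ⟨i | i, p⟩; exacts [t.1, t'.1])
      (by rintro ⟨i | i, p⟩; exacts [t.2, t'.2])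
      (fun i => Sum.elim (fun _ => a₁ + w) (fun _ => -a₁ + w) i.1)
      (by
        rintro ⟨i | i, p⟩
        · have := r₁.add rK
          rwa [← lineChernForm_add c₁.1 cK.1] at this
        · have := r₁'.add rK
          rwa [← lineChernForm_add c₁.1.neg cK.1] at this)
    convert this using 1
    rw [Fintype.sum_prod_type, Fintype.sum_sum_type]
    simp [← Nat.cast_smul_eq_nsmul ℂ]
  · have := isChernCharacter_of_diagonal (Quartic.virtualE L₁ L₂ K n).neg
      (fun i l v => Sum.elim (fun _ => L₂.e l v () ()) (fun _ => L₂.dual.e l v () ()) i)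
      (fun i v => Sum.elim (fun _ => θ₂ v) (fun _ => -θ₂ v) i)
      (fun l v => by
        ext i j
        rcases i with ⟨⟩ | ⟨⟩ <;> rcases j with ⟨⟩ | ⟨⟩ <;>
        simp [Quartic.virtualE, Bundle.sum])
      (by rintro (i | i); exacts [c₂.1, d₂.1])
      (by rintro (i | i); exacts [c₂.2, d₂.2])
      (fun i => Sum.elim (fun _ => a₂) (fun _ => -a₂) i)
      (by rintro (i | i); exacts [r₂, r₂'])
    convert this using 1
    simp

/-! ### Products of covectors -/

section Anticommuting

variable {R : Type*} [Ring R] [Algebra ℂ R] {u₀ u₁ u₂ u₃ : R}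

/-- The square of a skew-symmetric 2-form in four variables is given by its Pfaffian. -/
theorem sq_eq_pfaffian (s₀ : u₀ * u₀ = 0) (s₁ : u₁ * u₁ = 0) (s₂ : u₂ * u₂ = 0) (s₃ : u₃ * u₃ = 0)
    (h₁₀ : u₁ * u₀ = -(u₀ * u₁)) (h₂₀ : u₂ * u₀ = -(u₀ * u₂)) (h₃₀ : u₃ * u₀ = -(u₀ * u₃))
    (h₂₁ : u₂ * u₁ = -(u₁ * u₂)) (h₃₁ : u₃ * u₁ = -(u₁ * u₃)) (h₃₂ : u₃ * u₂ = -(u₂ * u₃))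
    (c₀₁ c₀₂ c₀₃ c₁₂ c₁₃ c₂₃ : ℂ) :
    (c₀₁ • (u₀ * u₁) + c₀₂ • (u₀ * u₂) + c₀₃ • (u₀ * u₃) + c₁₂ • (u₁ * u₂) + c₁₃ • (u₁ * u₃)
        + c₂₃ • (u₂ * u₃)) ^ 2
      = (2 * (c₀₁ * c₂₃ - c₀₂ * c₁₃ + c₀₃ * c₁₂)) • (u₀ * u₁ * u₂ * u₃) := by
  have t₀ : ∀ r, u₀ * (u₀ * r) = 0 := fun r => by rw [← mul_assoc, s₀, zero_mul]
  have t₁ : ∀ r, u₁ * (u₁ * r) = 0 := fun r => by rw [← mul_assoc, s₁, zero_mul]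
  have t₂ : ∀ r, u₂ * (u₂ * r) = 0 := fun r => by rw [← mul_assoc, s₂, zero_mul]
  have k₁₀ : ∀ r, u₁ * (u₀ * r) = -(u₀ * (u₁ * r)) := fun r => by
    rw [← mul_assoc, h₁₀, neg_mul, mul_assoc]
  have k₂₀ : ∀ r, u₂ * (u₀ * r) = -(u₀ * (u₂ * r)) := fun r => by
    rw [← mul_assoc, h₂₀, neg_mul, mul_assoc]
  have k₃₀ : ∀ r, u₃ * (u₀ * r) = -(u₀ * (u₃ * r)) := fun r => by
    rw [← mul_assoc, h₃₀, neg_mul, mul_assoc]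
  have k₂₁ : ∀ r, u₂ * (u₁ * r) = -(u₁ * (u₂ * r)) := fun r => by
    rw [← mul_assoc, h₂₁, neg_mul, mul_assoc]
  have k₃₁ : ∀ r, u₃ * (u₁ * r) = -(u₁ * (u₃ * r)) := fun r => by
    rw [← mul_assoc, h₃₁, neg_mul, mul_assoc]
  have k₃₂ : ∀ r, u₃ * (u₂ * r) = -(u₂ * (u₃ * r)) := fun r => by
    rw [← mul_assoc, h₃₂, neg_mul, mul_assoc]
  simp only [sq, mul_add, add_mul, smul_mul_assoc, mul_smul_comm, mul_assoc, s₁, s₂, s₃,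
    h₂₁, h₃₁, h₃₂, t₀, t₁, t₂, k₁₀, k₂₀, k₃₀, k₂₁, k₃₁, k₃₂, mul_neg, mul_zero,
    smul_zero, smul_neg, neg_zero, neg_neg]
  module

/-- Stated with anticommutation rules only, so that it serves the even and the odd covectors alike;
it reduces αβω to products of triple products. -/
theorem mul_covector (s₀ : u₀ * u₀ = 0) (s₁ : u₁ * u₁ = 0) (s₂ : u₂ * u₂ = 0) (s₃ : u₃ * u₃ = 0)
    (h₁₀ : u₁ * u₀ = -(u₀ * u₁)) (h₂₀ : u₂ * u₀ = -(u₀ * u₂)) (h₃₀ : u₃ * u₀ = -(u₀ * u₃))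
    (h₂₁ : u₂ * u₁ = -(u₁ * u₂)) (h₃₁ : u₃ * u₁ = -(u₁ * u₃)) (h₃₂ : u₃ * u₂ = -(u₂ * u₃))
    (c₀₁ c₀₂ c₀₃ c₁₂ c₁₃ c₂₃ : ℂ) {α : R}
    (hα : α = c₀₁ • (u₀ * u₁) + c₀₂ • (u₀ * u₂) + c₀₃ • (u₀ * u₃) + c₁₂ • (u₁ * u₂)
      + c₁₃ • (u₁ * u₃) + c₂₃ • (u₂ * u₃)) :
    α * u₀ = c₁₂ • (u₀ * u₁ * u₂) + c₁₃ • (u₀ * u₁ * u₃) + c₂₃ • (u₀ * u₂ * u₃) ∧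
    α * u₁ = (-c₀₂) • (u₀ * u₁ * u₂) + (-c₀₃) • (u₀ * u₁ * u₃) + c₂₃ • (u₁ * u₂ * u₃) ∧
    α * u₂ = c₀₁ • (u₀ * u₁ * u₂) + (-c₀₃) • (u₀ * u₂ * u₃) + (-c₁₃) • (u₁ * u₂ * u₃) ∧
    α * u₃ = c₀₁ • (u₀ * u₁ * u₃) + c₀₂ • (u₀ * u₂ * u₃) + c₁₂ • (u₁ * u₂ * u₃) := by
  have k₁₀ : ∀ r, u₁ * (u₀ * r) = -(u₀ * (u₁ * r)) := fun r => by
    rw [← mul_assoc, h₁₀, neg_mul, mul_assoc]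
  have k₂₀ : ∀ r, u₂ * (u₀ * r) = -(u₀ * (u₂ * r)) := fun r => by
    rw [← mul_assoc, h₂₀, neg_mul, mul_assoc]
  have t₀ : ∀ r, u₀ * (u₀ * r) = 0 := fun r => by rw [← mul_assoc, s₀, zero_mul]
  have t₁ : ∀ r, u₁ * (u₁ * r) = 0 := fun r => by rw [← mul_assoc, s₁, zero_mul]
  have t₂ : ∀ r, u₂ * (u₂ * r) = 0 := fun r => by rw [← mul_assoc, s₂, zero_mul]
  have k₂₁ : ∀ r, u₂ * (u₁ * r) = -(u₁ * (u₂ * r)) := fun r => by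
    rw [← mul_assoc, h₂₁, neg_mul, mul_assoc]
  subst hα
  refine ⟨?_, ?_, ?_, ?_⟩ <;>
  · simp only [add_mul, smul_mul_assoc, mul_assoc, s₁, s₂, s₃, t₀, t₁, t₂,
      h₁₀, h₂₀, h₃₀, h₂₁, h₃₁, h₃₂, k₁₀, k₂₀, k₂₁, mul_neg, mul_zero,
      smul_zero, smul_neg, neg_zero, neg_neg]
    module

end Anticommuting

/-- The 2-form `1/2 ∑ h_{jl} a_j ∧ a_l`. -/
def skewForm (h : Fin 4 → Fin 4 → ℂ) (a : Fin 4 → W) : Form :=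
  (2⁻¹ : ℂ) • ∑ j, ∑ l, h j l • (oneForm (a j) * oneForm (a l))

/-- The 2-form `∑ m_j a_j ∧ b_j`. -/
def diagForm (m : Fin 4 → ℂ) (a b : Fin 4 → W) : Form :=
  ∑ j, m j • (oneForm (a j) * oneForm (b j))

theorem skewForm_mem_center (h : Fin 4 → Fin 4 → ℂ) (a : Fin 4 → W) :
    skewForm h a ∈ Subalgebra.center ℂ Form :=
  Subalgebra.smul_mem _ (sum_mem fun _ _ => sum_mem fun _ _ =>
    Subalgebra.smul_mem _ (two_mem_center _ _) _) _

theorem diagForm_mem_center (m : Fin 4 → ℂ) (a b : Fin 4 → W) :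
    diagForm m a b ∈ Subalgebra.center ℂ Form :=
  sum_mem fun _ _ => Subalgebra.smul_mem _ (two_mem_center _ _) _

theorem two_mem_degree (f g : W) : oneForm f * oneForm g ∈ ⋀[ℂ]^2 W := by
  rw [show (2 : ℕ) = 1 + 1 from rfl]
  exact SetLike.mul_mem_graded (A := fun i : ℕ => ⋀[ℂ]^i W) (by simp) (by simp)

theorem skewForm_mem_degree (h : Fin 4 → Fin 4 → ℂ) (a : Fin 4 → W) :
    skewForm h a ∈ ⋀[ℂ]^2 W :=
  Submodule.smul_mem _ _ (sum_mem fun _ _ => sum_mem fun _ _ =>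
    Submodule.smul_mem _ _ (two_mem_degree _ _))

theorem diagForm_mem_degree (m : Fin 4 → ℂ) (a b : Fin 4 → W) :
    diagForm m a b ∈ ⋀[ℂ]^2 W :=
  sum_mem fun _ _ => Submodule.smul_mem _ _ (two_mem_degree _ _)

theorem skewForm_eq {h : Fin 4 → Fin 4 → ℂ} (hh : ∀ j l, h l j = -h j l) (a : Fin 4 → W) :
    skewForm h a = h 0 1 • (oneForm (a 0) * oneForm (a 1)) + h 0 2 • (oneForm (a 0) * oneForm (a 2))
      + h 0 3 • (oneForm (a 0) * oneForm (a 3)) + h 1 2 • (oneForm (a 1) * oneForm (a 2))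
      + h 1 3 • (oneForm (a 1) * oneForm (a 3)) + h 2 3 • (oneForm (a 2) * oneForm (a 3)) := by
  simp only [skewForm, Fin.sum_univ_four, oneForm_sq, smul_zero]
  rw [oneForm_swap (a 0) (a 1), oneForm_swap (a 0) (a 2), oneForm_swap (a 0) (a 3),
    oneForm_swap (a 1) (a 2), oneForm_swap (a 1) (a 3), oneForm_swap (a 2) (a 3),
    hh 0 1, hh 0 2, hh 0 3, hh 1 2, hh 1 3, hh 2 3]
  module

theorem skewForm_sq {h : Fin 4 → Fin 4 → ℂ} (hh : ∀ j l, h l j = -h j l) (a : Fin 4 → W) :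
    skewForm h a ^ 2 = (2 * (h 0 1 * h 2 3 - h 0 2 * h 1 3 + h 0 3 * h 1 2)) •
      (oneForm (a 0) * oneForm (a 1) * oneForm (a 2) * oneForm (a 3)) := by
  rw [skewForm_eq hh]
  exact sq_eq_pfaffian (oneForm_sq _) (oneForm_sq _) (oneForm_sq _) (oneForm_sq _)
    (oneForm_swap _ _) (oneForm_swap _ _) (oneForm_swap _ _) (oneForm_swap _ _) (oneForm_swap _ _)
    (oneForm_swap _ _) _ _ _ _ _ _

/-- The product of all `a_j` is annihilated by every `a_j`. -/
theorem prod_mul_covector (a : Fin 4 → W) (j : Fin 4) :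
    oneForm (a 0) * oneForm (a 1) * oneForm (a 2) * oneForm (a 3) * oneForm (a j) = 0 := by
  have t : ∀ i r, oneForm (a i) * (oneForm (a i) * r) = 0 := fun i r => by
    rw [← mul_assoc, oneForm_sq, zero_mul]
  have k : ∀ i l r, oneForm (a i) * (oneForm (a l) * r) = -(oneForm (a l) * (oneForm (a i) * r)) :=
    fun i l r => by rw [← mul_assoc, oneForm_swap, neg_mul, mul_assoc]
  fin_cases j
  · simp [mul_assoc, oneForm_swap (a 0) (a 3), k 2 0, k 1 0, t]
  · simp [mul_assoc, oneForm_swap (a 1) (a 3), k 2 1, t]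
  · simp [mul_assoc, oneForm_swap (a 2) (a 3), t]
  · simp [mul_assoc]

theorem prod_mul_diagForm (m : Fin 4 → ℂ) (a b : Fin 4 → W) :
    oneForm (a 0) * oneForm (a 1) * oneForm (a 2) * oneForm (a 3) * diagForm m a b = 0 := by
  rw [diagForm, Finset.mul_sum]
  refine Finset.sum_eq_zero fun j _ => ?_
  rw [mul_smul_comm, ← mul_assoc, prod_mul_covector, zero_mul, smul_zero]

theorem diagForm_swap (m : Fin 4 → ℂ) (a b : Fin 4 → W) :
    diagForm m b a = -diagForm m a b := by
  simp only [diagForm, ← Finset.sum_neg_distrib, ← smul_neg, ← oneForm_swap]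

/-- The product of three of the `a_j`. -/
def tripleForm (a : Fin 4 → W) (m : Fin 4) : Form :=
  oneForm (a (m.succAbove 0)) * oneForm (a (m.succAbove 1)) * oneForm (a (m.succAbove 2))

/-- By centrality the product is the sum of m_j (α a_j)(β b_j), which expands in the products
`tripleForm a i * tripleForm b l`. The hypothesis indexed by i, l says that the coefficient for i ≠
l vanishes. The surviving terms i = l contain only whole pairs a_j, b_j. -/
theorem skewForm_mul_skewForm_mul_diagForm {h : Fin 4 → Fin 4 → ℂ} (hh : ∀ j l, h l j = -h j l)
    (m : Fin 4 → ℂ) (a b : Fin 4 → W)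
    (h01 : m 2 * (h 0 3 * h 1 3) + m 3 * (h 0 2 * h 1 2) = 0)
    (h02 : m 3 * (h 0 1 * h 1 2) - m 1 * (h 0 3 * h 2 3) = 0)
    (h03 : m 1 * (h 0 2 * h 2 3) + m 2 * (h 0 1 * h 1 3) = 0)
    (h12 : m 0 * (h 1 3 * h 2 3) + m 3 * (h 0 1 * h 0 2) = 0)
    (h13 : m 0 * (h 1 2 * h 2 3) - m 2 * (h 0 1 * h 0 3) = 0)
    (h23 : m 0 * (h 1 2 * h 1 3) + m 1 * (h 0 2 * h 0 3) = 0) :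
    ∃ K : Fin 4 → ℂ, skewForm h a * skewForm h b * diagForm m a b
      = ∑ i, K i • (tripleForm a i * tripleForm b i) := by
  have ha := mul_covector (oneForm_sq (a 0)) (oneForm_sq (a 1)) (oneForm_sq (a 2))
    (oneForm_sq (a 3)) (oneForm_swap _ _) (oneForm_swap _ _) (oneForm_swap _ _) (oneForm_swap _ _)
    (oneForm_swap _ _) (oneForm_swap _ _) _ _ _ _ _ _ (skewForm_eq hh a)
  have hb := mul_covector (oneForm_sq (b 0)) (oneForm_sq (b 1)) (oneForm_sq (b 2))
    (oneForm_sq (b 3)) (oneForm_swap _ _) (oneForm_swap _ _) (oneForm_swap _ _) (oneForm_swap _ _)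
    (oneForm_swap _ _) (oneForm_swap _ _) _ _ _ _ _ _ (skewForm_eq hh b)
  have hc : ∀ j, skewForm h a * skewForm h b * (oneForm (a j) * oneForm (b j))
      = skewForm h a * oneForm (a j) * (skewForm h b * oneForm (b j)) := by
    intro j
    rw [mul_assoc, ← mul_assoc (skewForm h b), ← Subalgebra.mem_center_iff.mp
      (skewForm_mem_center h b) (oneForm (a j))]
    simp only [mul_assoc]
  -- Entry i is the sum over j ≠ i of m_j h_{pq}², where {p, q} is the complement of {i, j}.
  refine ⟨![m 1 * h 2 3 ^ 2 + m 2 * h 1 3 ^ 2 + m 3 * h 1 2 ^ 2,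
    m 0 * h 2 3 ^ 2 + m 2 * h 0 3 ^ 2 + m 3 * h 0 2 ^ 2,
    m 0 * h 1 3 ^ 2 + m 1 * h 0 3 ^ 2 + m 3 * h 0 1 ^ 2,
    m 0 * h 1 2 ^ 2 + m 1 * h 0 2 ^ 2 + m 2 * h 0 1 ^ 2], ?_⟩
  have e : ∀ u : Fin 4 → W,
      tripleForm u 0 = oneForm (u 1) * oneForm (u 2) * oneForm (u 3) ∧
      tripleForm u 1 = oneForm (u 0) * oneForm (u 2) * oneForm (u 3) ∧
      tripleForm u 2 = oneForm (u 0) * oneForm (u 1) * oneForm (u 3) ∧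
      tripleForm u 3 = oneForm (u 0) * oneForm (u 1) * oneForm (u 2) := fun u =>
    ⟨rfl, rfl, rfl, rfl⟩
  rw [diagForm]
  simp only [Fin.sum_univ_four, mul_add, mul_smul_comm, hc]
  rw [ha.1, ha.2.1, ha.2.2.1, ha.2.2.2, hb.1, hb.2.1, hb.2.2.1, hb.2.2.2,
    ← (e a).1, ← (e a).2.1, ← (e a).2.2.1, ← (e a).2.2.2,
    ← (e b).1, ← (e b).2.1, ← (e b).2.2.1, ← (e b).2.2.2]
  simp only [mul_add, add_mul, smul_mul_assoc, mul_smul_comm, smul_smul, smul_add]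
  simp only [Matrix.cons_val]
  linear_combination (norm := module)
    h01 • (tripleForm a 0 * tripleForm b 1 + tripleForm a 1 * tripleForm b 0)
    + h02 • (tripleForm a 0 * tripleForm b 2 + tripleForm a 2 * tripleForm b 0)
    - h03 • (tripleForm a 0 * tripleForm b 3 + tripleForm a 3 * tripleForm b 0)
    + h12 • (tripleForm a 1 * tripleForm b 2 + tripleForm a 2 * tripleForm b 1)
    + h13 • (tripleForm a 1 * tripleForm b 3 + tripleForm a 3 * tripleForm b 1)
    + h23 • (tripleForm a 2 * tripleForm b 3 + tripleForm a 3 * tripleForm b 2)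

namespace Quartic

variable (P : Quartic)

/-! ### The roots -/

/-- Vieta's formulas by divided differences: `d1` and `d2` are the first and second ones, which
vanish at distinct roots, and the third gives the sum of the roots. -/
theorem root_sums {a b c d : ℝ} (ha : a ≠ 0) {y : Fin 4 → ℝ} (hy : Function.Injective y)
    (h : ∀ j, a * y j ^ 4 + b * y j ^ 2 + c * y j + d = 0) :
    y 0 + y 1 + y 2 + y 3 = 0 ∧
    y 0 * y 1 + y 0 * y 2 + y 0 * y 3 + y 1 * y 2 + y 1 * y 3 + y 2 * y 3 = b / a ∧
    y 0 * y 1 * y 2 + y 0 * y 1 * y 3 + y 0 * y 2 * y 3 + y 1 * y 2 * y 3 = -(c / a) := by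
  have hne : ∀ i j : Fin 4, i ≠ j → y i - y j ≠ 0 := fun i j hij =>
    sub_ne_zero.mpr fun e => hij (hy e)
  have d1 : ∀ i j : Fin 4, i ≠ j →
      a * (y i ^ 3 + y i ^ 2 * y j + y i * y j ^ 2 + y j ^ 3) + b * (y i + y j) + c = 0 := by
    intro i j hij
    refine (mul_eq_zero.mp ?_).resolve_left (hne i j hij)
    linear_combination h i - h j
  have d2 : ∀ i j k : Fin 4, i ≠ j → i ≠ k → j ≠ k →
      a * (y i ^ 2 + y j ^ 2 + y k ^ 2 + y i * y j + y i * y k + y j * y k) + b = 0 := by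
    intro i j k hij hik hjk
    refine (mul_eq_zero.mp ?_).resolve_left (hne j k hjk)
    linear_combination d1 i j hij - d1 i k hik
  have s : y 0 + y 1 + y 2 + y 3 = 0 := by
    refine (mul_eq_zero.mp ?_).resolve_left (mul_ne_zero ha (hne 2 3 (by decide)))
    linear_combination d2 0 1 2 (by decide) (by decide) (by decide)
      - d2 0 1 3 (by decide) (by decide) (by decide)
  refine ⟨s, ?_, ?_⟩
  · have := d2 0 1 2 (by decide) (by decide) (by decide)
    field_simp
    linear_combination (y 0 + y 1 + y 2) * a * s - this
  · have h1 := d1 0 1 (by decide)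
    have := d2 0 1 2 (by decide) (by decide) (by decide)
    field_simp
    linear_combination h1 - (y 0 + y 1) * this + a * (y 0 * y 1 + y 0 * y 2 + y 1 * y 2) * s

theorem a_ne_zero : P.a ≠ 0 := by
  intro ha
  have h : ∀ j, (P.b : ℝ) * P.x j ^ 2 + P.c * P.x j + P.d = 0 := fun j => by
    simpa [ha] using P.isRoot j
  have hne : ∀ i j : Fin 4, i ≠ j → P.x i - P.x j ≠ 0 := fun i j hij =>
    sub_ne_zero.mpr fun e => hij (P.strictAnti.injective e)
  have d1 : ∀ i j : Fin 4, i ≠ j → (P.b : ℝ) * (P.x i + P.x j) + P.c = 0 := by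
    intro i j hij
    refine (mul_eq_zero.mp ?_).resolve_left (hne i j hij)
    linear_combination h i - h j
  have hb : (P.b : ℝ) = 0 := by
    refine (mul_eq_zero.mp ?_).resolve_left (hne 1 2 (by decide))
    linear_combination d1 0 1 (by decide) - d1 0 2 (by decide)
  have hc : (P.c : ℝ) = 0 := by simpa [hb] using d1 0 1 (by decide)
  have hd : (P.d : ℝ) = 0 := by simpa [hb, hc] using h 0
  refine P.irreducible.ne_zero ?_
  simp [ha, Rat.cast_eq_zero.mp hb, Rat.cast_eq_zero.mp hc, Rat.cast_eq_zero.mp hd]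

/-- The coefficient `b / a`. -/
def B : ℚ := P.b / P.a

/-- The coefficient `c / a`. -/
def C : ℚ := P.c / P.a

theorem root_sums_comp (σ : Equiv.Perm (Fin 4)) :
    P.x (σ 0) + P.x (σ 1) + P.x (σ 2) + P.x (σ 3) = 0 ∧
    P.x (σ 0) * P.x (σ 1) + P.x (σ 0) * P.x (σ 2) + P.x (σ 0) * P.x (σ 3) + P.x (σ 1) * P.x (σ 2)
      + P.x (σ 1) * P.x (σ 3) + P.x (σ 2) * P.x (σ 3) = P.B ∧
    P.x (σ 0) * P.x (σ 1) * P.x (σ 2) + P.x (σ 0) * P.x (σ 1) * P.x (σ 3)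
      + P.x (σ 0) * P.x (σ 2) * P.x (σ 3) + P.x (σ 1) * P.x (σ 2) * P.x (σ 3) = -P.C := by
  have := root_sums (y := P.x ∘ σ) (Rat.cast_ne_zero.mpr P.a_ne_zero)
    (P.strictAnti.injective.comp σ.injective) (fun j => P.isRoot (σ j))
  simpa [B, C] using this

theorem root_sums_one :
    P.x 0 + P.x 1 + P.x 2 + P.x 3 = 0 ∧
    P.x 0 * P.x 1 + P.x 0 * P.x 2 + P.x 0 * P.x 3 + P.x 1 * P.x 2
      + P.x 1 * P.x 3 + P.x 2 * P.x 3 = P.B ∧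
    P.x 0 * P.x 1 * P.x 2 + P.x 0 * P.x 1 * P.x 3
      + P.x 0 * P.x 2 * P.x 3 + P.x 1 * P.x 2 * P.x 3 = -P.C := P.root_sums_comp 1

/-- The coefficient of `dz_j ∧ dz_l` in `A₁` as a polynomial in `x_j` and `x_l`. -/
def hR (j l : Fin 4) : ℝ := (P.B + (P.x j + P.x l) ^ 2) * (P.x j - P.x l)

theorem hR_swap (j l : Fin 4) : P.hR l j = -P.hR j l := by
  simp only [hR]; ring

/-- The second symmetric function is y₀y₂ + y₁y₃ + (y₀ + y₂)(y₁ + y₃), and y₁ + y₃ = -(y₀ + y₂) as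
there is no cubic term. So the coefficient depends only on the two indices of its edge, through a
polynomial over ℚ. -/
theorem coeff02_comp (σ : Equiv.Perm (Fin 4)) : coeff02 (P.x ∘ σ) = P.hR (σ 0) (σ 2) := by
  obtain ⟨h1, h2, -⟩ := P.root_sums_comp σ
  simp only [coeff02, hR, Function.comp]
  rw [← h2, show P.x (σ 3) = -(P.x (σ 0) + P.x (σ 1) + P.x (σ 2)) by linarith]
  ring

theorem hR_eq :
    P.hR 0 1 = (P.x 0 * P.x 1 + P.x 2 * P.x 3) * (P.x 0 - P.x 1) ∧
    P.hR 0 2 = (P.x 0 * P.x 2 + P.x 1 * P.x 3) * (P.x 0 - P.x 2) ∧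
    P.hR 0 3 = (P.x 0 * P.x 3 + P.x 1 * P.x 2) * (P.x 0 - P.x 3) ∧
    P.hR 1 2 = (P.x 0 * P.x 3 + P.x 1 * P.x 2) * (P.x 1 - P.x 2) ∧
    P.hR 1 3 = (P.x 0 * P.x 2 + P.x 1 * P.x 3) * (P.x 1 - P.x 3) ∧
    P.hR 2 3 = (P.x 0 * P.x 1 + P.x 2 * P.x 3) * (P.x 2 - P.x 3) := by
  obtain ⟨h1, h2, -⟩ := P.root_sums_one
  simp only [hR]
  rw [← h2, show P.x 3 = -(P.x 0 + P.x 1 + P.x 2) by linarith]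
  refine ⟨?_, ?_, ?_, ?_, ?_, ?_⟩ <;> ring

theorem μ_eq :
    P.μ 0 = (P.x 0 - P.x 1) * (P.x 0 - P.x 2) * (P.x 0 - P.x 3) ∧
    P.μ 1 = (P.x 1 - P.x 0) * (P.x 1 - P.x 2) * (P.x 1 - P.x 3) ∧
    P.μ 2 = (P.x 2 - P.x 0) * (P.x 2 - P.x 1) * (P.x 2 - P.x 3) ∧
    P.μ 3 = (P.x 3 - P.x 0) * (P.x 3 - P.x 1) * (P.x 3 - P.x 2) := by
  have e0 : (Finset.univ : Finset (Fin 4)).erase 0 = {1, 2, 3} := by decide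
  have e1 : (Finset.univ : Finset (Fin 4)).erase 1 = {0, 2, 3} := by decide
  have e2 : (Finset.univ : Finset (Fin 4)).erase 2 = {0, 1, 3} := by decide
  have e3 : (Finset.univ : Finset (Fin 4)).erase 3 = {0, 1, 2} := by decide
  simp [μ, e0, e1, e2, e3, mul_assoc]

theorem 𝔻_pos : 0 < P.𝔻 := by
  have h : ∀ i j : Fin 4, i < j → 0 < P.x i - P.x j := fun i j hij =>
    sub_pos.mpr (P.strictAnti hij)
  have h01 := h 0 1 (by decide)
  have h02 := h 0 2 (by decide)
  have h03 := h 0 3 (by decide)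
  have h12 := h 1 2 (by decide)
  have h13 := h 1 3 (by decide)
  have h23 := h 2 3 (by decide)
  simp only [𝔻, vandermonde]
  positivity

theorem prod_μ : P.μ 0 * P.μ 1 * P.μ 2 * P.μ 3 = P.𝔻 ^ 2 := by
  obtain ⟨h0, h1, h2, h3⟩ := P.μ_eq
  rw [h0, h1, h2, h3, 𝔻, vandermonde]
  ring

theorem Δ_eq_𝔻 : (P.Δ : ℝ) = P.𝔻 ^ 2 := P.Δ_eq

/-- Let u, v, w be the resolvents x₀x₁ + x₂x₃, x₀x₂ + x₁x₃, x₀x₃ + x₁x₂. The products of opposite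
differences are v - w, u - w, u - v, so the Pfaffian is u²(v - w) - v²(u - w) + w²(u - v) = (u -
v)(u - w)(v - w), which is 𝔻. -/
theorem pfaffian_eq :
    P.hR 0 1 * P.hR 2 3 - P.hR 0 2 * P.hR 1 3 + P.hR 0 3 * P.hR 1 2 = P.𝔻 := by
  obtain ⟨h01, h02, h03, h12, h13, h23⟩ := P.hR_eq
  rw [h01, h02, h03, h12, h13, h23, 𝔻, vandermonde]
  ring

/-- In each line both terms carry the same two resolvents as factors; what remains are products of
differences of roots that cancel through one opposite sign. -/
theorem orthogonality :
    P.μ 2 * (P.hR 0 3 * P.hR 1 3) + P.μ 3 * (P.hR 0 2 * P.hR 1 2) = 0 ∧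
    P.μ 3 * (P.hR 0 1 * P.hR 1 2) - P.μ 1 * (P.hR 0 3 * P.hR 2 3) = 0 ∧
    P.μ 1 * (P.hR 0 2 * P.hR 2 3) + P.μ 2 * (P.hR 0 1 * P.hR 1 3) = 0 ∧
    P.μ 0 * (P.hR 1 3 * P.hR 2 3) + P.μ 3 * (P.hR 0 1 * P.hR 0 2) = 0 ∧
    P.μ 0 * (P.hR 1 2 * P.hR 2 3) - P.μ 2 * (P.hR 0 1 * P.hR 0 3) = 0 ∧
    P.μ 0 * (P.hR 1 2 * P.hR 1 3) + P.μ 1 * (P.hR 0 2 * P.hR 0 3) = 0 := by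
  obtain ⟨h01, h02, h03, h12, h13, h23⟩ := P.hR_eq
  obtain ⟨m0, m1, m2, m3⟩ := P.μ_eq
  rw [h01, h02, h03, h12, h13, h23, m0, m1, m2, m3]
  refine ⟨?_, ?_, ?_, ?_, ?_, ?_⟩ <;> ring

/-- The divided difference of the quartic, divided by its leading coefficient. -/
def kernel (j l : Fin 4) : ℝ :=
  P.x j ^ 3 + P.x j ^ 2 * P.x l + P.x j * P.x l ^ 2 + P.x l ^ 3 + P.B * (P.x j + P.x l) + P.C

/-- The divided difference is zero at two distinct roots, and on the diagonal it is the derivative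
divided by the leading coefficient. This turns the diagonal form ω into a double sum with
coefficients polynomial over ℚ in x_j and x_l. -/
theorem kernel_eq (j l : Fin 4) : P.kernel j l = if j = l then P.μ j else 0 := by
  split_ifs with h
  · subst h
    obtain ⟨h1, h2, h3⟩ := P.root_sums_one
    obtain ⟨m0, m1, m2, m3⟩ := P.μ_eq
    have hC : (P.C : ℝ) = -(P.x 0 * P.x 1 * P.x 2 + P.x 0 * P.x 1 * P.x 3
      + P.x 0 * P.x 2 * P.x 3 + P.x 1 * P.x 2 * P.x 3) := by linarith
    rw [kernel, ← h2, hC]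
    have h4 : P.x 3 = -(P.x 0 + P.x 1 + P.x 2) := by linarith
    fin_cases j
    · simp only [Fin.zero_eta, m0, h4]; ring
    · simp only [Fin.mk_one, m1, h4]; ring
    · simp only [Fin.reduceFinMk, m2, h4]; ring
    · simp only [Fin.reduceFinMk, m3, h4]; ring
  · have ha : (P.a : ℝ) ≠ 0 := Rat.cast_ne_zero.mpr P.a_ne_zero
    have hne : P.x j - P.x l ≠ 0 := sub_ne_zero.mpr fun e => h (P.strictAnti.injective e)
    refine (mul_eq_zero.mp ?_).resolve_left (mul_ne_zero ha hne)
    have hB : (P.B : ℝ) * P.a = P.b := by rw [B]; push_cast; field_simp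
    have hC : (P.C : ℝ) * P.a = P.c := by rw [C]; push_cast; field_simp
    rw [kernel]
    linear_combination P.isRoot j - P.isRoot l + (P.x j ^ 2 - P.x l ^ 2) * hB
      + (P.x j - P.x l) * hC

/-! ### The classes as skew and diagonal forms -/

/-- The covector `z_j` or `\bar z_j` belonging to a vertex of the cube. -/
def vertexFun (j : Fin 4) (s : ℤˣ) : W := if s = (-1) ^ (j : ℕ) then zFun j else zbarFun j

theorem dzVertex_eq (j : Fin 4) (s : ℤˣ) : dzVertex j s = oneForm (vertexFun j s) := by
  unfold dzVertex vertexFun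
  split_ifs <;> rfl

/-- The covectors `z_0`, `\bar z_1`, `z_2`, `\bar z_3`. -/
def evenFun (j : Fin 4) : W := vertexFun j 1

/-- The covectors `\bar z_0`, `z_1`, `\bar z_2`, `z_3`. -/
def oddFun (j : Fin 4) : W := vertexFun j (-1)

theorem evenFun_eq : evenFun 0 = zFun 0 ∧ evenFun 1 = zbarFun 1 ∧ evenFun 2 = zFun 2 ∧
    evenFun 3 = zbarFun 3 := by
  simp +decide [evenFun, vertexFun]

theorem oddFun_eq : oddFun 0 = zbarFun 0 ∧ oddFun 1 = zFun 1 ∧ oddFun 2 = zbarFun 2 ∧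
    oddFun 3 = zFun 3 := by
  simp +decide [oddFun, vertexFun]

/-- The coefficients of `A₁`. -/
def h (j l : Fin 4) : ℂ := (P.hR j l : ℂ)

theorem h_swap (j l : Fin 4) : P.h l j = -P.h j l := by
  rw [h, hR_swap, Complex.ofReal_neg, h]

/-- Each ordered pair of distinct indices is (σ 0, σ 2) for exactly two permutations. With the
factor 1/4 of `galoisForm` this leaves the 1/2 of `skewForm`. -/
theorem sum_perm_apply {A : Type*} [AddCommMonoid A] [Module ℂ A] (F : Fin 4 → Fin 4 → A)
    (hF : ∀ j, F j j = 0) :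
    ∑ σ : Equiv.Perm (Fin 4), F (σ 0) (σ 2) = (2 : ℂ) • ∑ j, ∑ l, F j l := by
  have hcard : ∀ p : Fin 4 × Fin 4,
      (Finset.univ.filter fun σ : Equiv.Perm (Fin 4) => (σ 0, σ 2) = p).card
        = if p.1 = p.2 then 0 else 2 := by decide
  rw [← Finset.sum_fiberwise (s := Finset.univ)
    (g := fun σ : Equiv.Perm (Fin 4) => (σ 0, σ 2)), ← Fintype.sum_prod_type', Finset.smul_sum]
  refine Finset.sum_congr rfl fun p _ => ?_
  rw [Finset.sum_congr rfl (g := fun _ => F p.1 p.2), Finset.sum_const, hcard]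
  · split_ifs with hp
    · rw [hp, hF]; simp
    · rw [← Nat.cast_smul_eq_nsmul ℂ]; norm_num
  · intro σ hσ
    rw [← (Finset.mem_filter.mp hσ).2]

/-- Both covectors of a term carry the sign `sign σ * ε`. Taking this sign as the summation variable
instead of ε splits the orbit into the two tetrahedra. -/
theorem galoisForm_eq (s : ℤˣ → ℂ) (coeff : Equiv.Perm (Fin 4) → ℤˣ → ℂ)
    (hc : ∀ σ ε, coeff σ ε = s (Equiv.Perm.sign σ * ε) * P.h (σ 0) (σ 2)) :
    galoisForm coeff = s 1 • skewForm P.h evenFun + s (-1) • skewForm P.h oddFun := by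
  have hs : ∀ σ : Equiv.Perm (Fin 4), ∑ ε : ℤˣ, coeff σ ε •
      (dzVertex (σ 0) (Equiv.Perm.sign σ * ε) * dzVertex (σ 2) (Equiv.Perm.sign σ * ε))
      = ∑ ε : ℤˣ, s ε • (P.h (σ 0) (σ 2) • (dzVertex (σ 0) ε * dzVertex (σ 2) ε)) := by
    intro σ
    simp only [hc, ← smul_smul]
    exact Equiv.sum_comp (Equiv.mulLeft (Equiv.Perm.sign σ))
      (fun ε => s ε • (P.h (σ 0) (σ 2) • (dzVertex (σ 0) ε * dzVertex (σ 2) ε)))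
  have h0 : ∀ j, P.h j j = 0 := fun j => by simp [h, hR]
  have hu : ∀ f : ℤˣ → Form, ∑ ε : ℤˣ, f ε = f 1 + f (-1) := fun f => by
    rw [show (Finset.univ : Finset ℤˣ) = {1, -1} from rfl, Finset.sum_pair (by decide)]
  rw [galoisForm, Finset.sum_congr rfl fun σ _ => hs σ]
  simp only [hu, Finset.sum_add_distrib, ← Finset.smul_sum]
  rw [sum_perm_apply (fun j l => P.h j l • (dzVertex j 1 * dzVertex l 1))
      (fun j => by rw [h0, zero_smul]),
    sum_perm_apply (fun j l => P.h j l • (dzVertex j (-1) * dzVertex l (-1)))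
      (fun j => by rw [h0, zero_smul])]
  simp only [skewForm, dzVertex_eq, evenFun, oddFun]
  module

theorem A₁_eq : P.A₁ = skewForm P.h evenFun + skewForm P.h oddFun := by
  rw [A₁, P.galoisForm_eq (fun _ => 1) _ (fun σ ε => by rw [coeff02_comp, one_mul, h]), one_smul,
    one_smul]

theorem vandermonde_comp (σ : Equiv.Perm (Fin 4)) (y : Fin 4 → ℝ) :
    vandermonde (y ∘ σ) = ((Equiv.Perm.sign σ : ℤˣ) : ℤ) * vandermonde y := by
  induction σ using Equiv.Perm.swap_induction_on generalizing y with
  | one => simp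
  | swap_mul f i j hij ih =>
    rw [show y ∘ (Equiv.swap i j * f) = (y ∘ Equiv.swap i j) ∘ f from rfl, ih, Equiv.Perm.sign_mul,
      Equiv.Perm.sign_swap hij]
    have : vandermonde (y ∘ Equiv.swap i j) = -vandermonde y := by
      fin_cases i <;> fin_cases j <;> first | exact absurd rfl hij | skip
      all_goals
        simp +decide [vandermonde, Equiv.swap_apply_def]
        ring
    rw [this]
    push_cast
    ring

theorem A₂_eq (c : ℤ) : P.A₂ c = (Complex.I * c * P.𝔻) •
    (skewForm P.h evenFun - skewForm P.h oddFun) := by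
  rw [A₂, P.galoisForm_eq (fun s => ((s : ℤ) : ℂ) * (Complex.I * c * P.𝔻)) _ (fun σ ε => ?_)]
  · push_cast
    module
  · rw [coeff02_comp, h, vandermonde_comp, 𝔻]
    push_cast
    ring

/-- For odd j the even covector is \bar z_j, and reversing dz_j ∧ d\bar z_j absorbs the sign (-1)^j.
-/
theorem omegaForm_eq : P.omegaForm = (Complex.I / P.𝔻) •
    diagForm (fun j => (P.μ j : ℂ)) evenFun oddFun := by
  have hD : (P.𝔻 : ℂ) ≠ 0 := Complex.ofReal_ne_zero.mpr P.𝔻_pos.ne'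
  have hΔ : (P.Δ : ℂ) = (P.𝔻 : ℂ) ^ 2 := by
    have := congrArg (fun r : ℝ => (r : ℂ)) P.Δ_eq_𝔻
    simpa using this
  have hs : Complex.I * (P.𝔻 : ℂ) / (P.Δ : ℂ) = Complex.I / P.𝔻 := by
    rw [hΔ]; field_simp
  rw [omegaForm, hs, diagForm]
  congr 1
  obtain ⟨e0, e1, e2, e3⟩ := evenFun_eq
  obtain ⟨o0, o1, o2, o3⟩ := oddFun_eq
  simp only [Fin.sum_univ_four, e0, e1, e2, e3, o0, o1, o2, o3]
  rw [oneForm_swap (zFun 1) (zbarFun 1), oneForm_swap (zFun 3) (zbarFun 3)]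
  simp [dz, dzbar, pow_succ]

theorem M_eq : P.M = (P.𝔻 : ℂ) •
    (oneForm (evenFun 0) * oneForm (evenFun 1) * oneForm (evenFun 2) * oneForm (evenFun 3)
      + oneForm (oddFun 0) * oneForm (oddFun 1) * oneForm (oddFun 2) * oneForm (oddFun 3)) := by
  obtain ⟨e0, e1, e2, e3⟩ := evenFun_eq
  obtain ⟨o0, o1, o2, o3⟩ := oddFun_eq
  rw [e0, e1, e2, e3, o0, o1, o2, o3]
  rfl

theorem skewForm_h_sq (a : Fin 4 → W) : skewForm P.h a ^ 2 = (2 * (P.𝔻 : ℂ)) •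
    (oneForm (a 0) * oneForm (a 1) * oneForm (a 2) * oneForm (a 3)) := by
  rw [skewForm_sq P.h_swap, ← P.pfaffian_eq]
  simp [h]

/-- The squares of the two components of `A₁` add up to `2 M`. -/
theorem skewForm_sq_add : skewForm P.h evenFun ^ 2 + skewForm P.h oddFun ^ 2 = (2 : ℂ) • P.M := by
  rw [skewForm_h_sq, skewForm_h_sq, M_eq]
  module

theorem skewForm_sq_mul_omegaForm :
    skewForm P.h evenFun ^ 2 * P.omegaForm = 0 ∧ skewForm P.h oddFun ^ 2 * P.omegaForm = 0 := by
  rw [skewForm_h_sq, skewForm_h_sq, omegaForm_eq]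
  constructor
  · rw [smul_mul_smul_comm, prod_mul_diagForm, smul_zero]
  · rw [smul_mul_smul_comm, ← neg_neg (diagForm _ evenFun oddFun), ← diagForm_swap, mul_neg,
      prod_mul_diagForm, neg_zero, smul_zero]

end Quartic

/-! ### Hodge types -/

/-- Covectors anticommute, and a sign does not change a span; hence products of Hodge types can be
regrouped. -/
theorem commute_type : Commute type10 type01 := by
  have key : ∀ S T : Set Form, (∀ s ∈ S, ∃ f : W, s = oneForm f) →
      (∀ t ∈ T, ∃ f : W, t = oneForm f) →
      Submodule.span ℂ S * Submodule.span ℂ T ≤ Submodule.span ℂ T * Submodule.span ℂ S := by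
    intro S T hS hT
    rw [Submodule.span_mul_span, Submodule.span_le]
    rintro _ ⟨s, hs, t, ht, rfl⟩
    obtain ⟨f, rfl⟩ := hS s hs
    obtain ⟨g, rfl⟩ := hT t ht
    change oneForm f * oneForm g ∈ _
    rw [oneForm_swap]
    exact Submodule.neg_mem _ (Submodule.mul_mem_mul (Submodule.subset_span ht)
      (Submodule.subset_span hs))
  refine le_antisymm (key _ _ ?_ ?_) (key _ _ ?_ ?_) <;>
  · rintro _ ⟨f, rfl⟩
    exact ⟨_, rfl⟩

theorem hodgeType_mul {p q p' q' : ℕ} {α β : Form} (hα : α ∈ hodgeType p q)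
    (hβ : β ∈ hodgeType p' q') : α * β ∈ hodgeType (p + p') (q + q') := by
  have h : hodgeType p q * hodgeType p' q' = hodgeType (p + p') (q + q') := by
    simp only [hodgeType, pow_add]
    rw [mul_assoc, ← mul_assoc (type01 ^ q), ((commute_type.pow_pow p' q).eq).symm]
    simp only [mul_assoc]
  rw [← h]
  exact Submodule.mul_mem_mul hα hβ

theorem dz_mem (j : Fin 4) : oneForm (zFun j) ∈ type10 :=
  Submodule.subset_span ⟨ContinuousLinearMap.proj j, rfl⟩

theorem dzbar_mem (j : Fin 4) : oneForm (zbarFun j) ∈ type01 :=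
  Submodule.subset_span ⟨ContinuousLinearMap.proj j, rfl⟩

theorem pair_mem_hodgeType (j l : Fin 4) :
    oneForm (zFun j) * oneForm (zbarFun l) ∈ hodgeType 1 1 := by
  rw [hodgeType, pow_one, pow_one]
  exact Submodule.mul_mem_mul (dz_mem j) (dzbar_mem l)

theorem pair_mem_hodgeType' (j l : Fin 4) :
    oneForm (zbarFun j) * oneForm (zFun l) ∈ hodgeType 1 1 := by
  rw [oneForm_swap]
  exact Submodule.neg_mem _ (pair_mem_hodgeType l j)

theorem diagForm_mem_hodgeType {a b : Fin 4 → W}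
    (hab : ∀ j, oneForm (a j) * oneForm (b j) ∈ hodgeType 1 1) (m : Fin 4 → ℂ) :
    diagForm m a b ∈ hodgeType 1 1 :=
  sum_mem fun j _ => Submodule.smul_mem _ _ (hab j)

theorem triple_mul_triple (u v w x y z : W) :
    oneForm u * oneForm v * oneForm w * (oneForm x * oneForm y * oneForm z)
      = -(oneForm u * oneForm x * (oneForm v * oneForm y) * (oneForm w * oneForm z)) := by
  have k : ∀ (f g : W) r, oneForm f * (oneForm g * r) = -(oneForm g * (oneForm f * r)) :=
    fun f g r => by rw [← mul_assoc, oneForm_swap, neg_mul, mul_assoc]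
  simp only [mul_assoc]
  rw [k w x, k w y]
  simp only [mul_neg, neg_neg]
  rw [k v x]
  simp

theorem tripleForm_mem_hodgeType {a b : Fin 4 → W}
    (hab : ∀ j, oneForm (a j) * oneForm (b j) ∈ hodgeType 1 1) (i : Fin 4) :
    tripleForm a i * tripleForm b i ∈ hodgeType 3 3 := by
  rw [tripleForm, tripleForm, triple_mul_triple]
  exact Submodule.neg_mem _ (hodgeType_mul (p := 2) (q := 2) (p' := 1) (q' := 1)
    (hodgeType_mul (p := 1) (q := 1) (p' := 1) (q' := 1) (hab _) (hab _)) (hab _))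

/-! ### The Chern character of the virtual bundle -/

/-- Odd powers of α + β and of α - β cancel. In degree 4, g² = -n makes the subtracted square add
n(α - β)² to n(α + β)², so αβ drops out. The fourth powers are left unexpanded: only their degree is
needed. -/
theorem truncated_exp_identity {R : Type*} [CommRing R] [Algebra ℂ R] (α β w : R) {g n : ℂ} (k : ℂ)
    (hg : g ^ 2 = -n) :
    n • (∑ m ∈ Finset.range 5, ((m.factorial : ℂ)⁻¹) • (α + β + k • w) ^ m
        + ∑ m ∈ Finset.range 5, ((m.factorial : ℂ)⁻¹) • (-(α + β) + k • w) ^ m)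
      - (∑ m ∈ Finset.range 5, ((m.factorial : ℂ)⁻¹) • (g • (α - β)) ^ m
        + ∑ m ∈ Finset.range 5, ((m.factorial : ℂ)⁻¹) • (-(g • (α - β))) ^ m)
      = (2 * n * k) • w + (2 * n) • (α ^ 2 + β ^ 2) + (k ^ 2 * n) • w ^ 2
        + ((2 * n - 2) • (1 : R) + n • ((k ^ 3 / 3) • w ^ 3 + k • ((α + β) ^ 2 * w))
        + ((n / 24) • ((α + β + k • w) ^ 4 + (-(α + β) + k • w) ^ 4)
          - (12⁻¹ : ℂ) • (g • (α - β)) ^ 4)) := by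
  simp only [Finset.sum_range_succ, Finset.sum_range_zero, Nat.factorial]
  obtain rfl : n = -g ^ 2 := by rw [hg, neg_neg]
  norm_num
  algebra

theorem expForm_identity {α β w : Form} (hα : α ∈ Subalgebra.center ℂ Form)
    (hβ : β ∈ Subalgebra.center ℂ Form) (hw : w ∈ Subalgebra.center ℂ Form) {g n : ℂ} (k : ℂ)
    (hg : g ^ 2 = -n) :
    n • (expForm (α + β + k • w) + expForm (-(α + β) + k • w))
      - (expForm (g • (α - β)) + expForm (-(g • (α - β))))
      = (2 * n * k) • w + (2 * n) • (α ^ 2 + β ^ 2) + (k ^ 2 * n) • w ^ 2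
        + ((2 * n - 2) • (1 : Form) + n • ((k ^ 3 / 3) • w ^ 3 + k • ((α + β) ^ 2 * w))
        + ((n / 24) • ((α + β + k • w) ^ 4 + (-(α + β) + k • w) ^ 4)
          - (12⁻¹ : ℂ) • (g • (α - β)) ^ 4)) := by
  obtain ⟨α, rfl⟩ : ∃ a : Subalgebra.center ℂ Form, (a : Form) = α := ⟨⟨α, hα⟩, rfl⟩
  obtain ⟨β, rfl⟩ : ∃ a : Subalgebra.center ℂ Form, (a : Form) = β := ⟨⟨β, hβ⟩, rfl⟩
  obtain ⟨w, rfl⟩ : ∃ a : Subalgebra.center ℂ Form, (a : Form) = w := ⟨⟨w, hw⟩, rfl⟩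
  have h := congrArg (Subalgebra.center ℂ Form).val (truncated_exp_identity α β w k hg)
  simp only [map_add, map_smul, map_pow, map_mul, map_one] at h
  exact h

/-! ### Hodge types, degrees and Chern classes for the quartic -/

namespace Quartic

variable (P : Quartic)

theorem pair_mem (j : Fin 4) :
    oneForm (evenFun j) * oneForm (oddFun j) ∈ hodgeType 1 1 := by
  obtain ⟨e0, e1, e2, e3⟩ := evenFun_eq
  obtain ⟨o0, o1, o2, o3⟩ := oddFun_eq
  fin_cases j
  · simpa only [Fin.zero_eta, e0, o0] using pair_mem_hodgeType 0 0
  · simpa only [Fin.mk_one, e1, o1] using pair_mem_hodgeType' 1 1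
  · simpa only [Fin.reduceFinMk, e2, o2] using pair_mem_hodgeType 2 2
  · simpa only [Fin.reduceFinMk, e3, o3] using pair_mem_hodgeType' 3 3

theorem omegaForm_mem_center : P.omegaForm ∈ Subalgebra.center ℂ Form := by
  rw [omegaForm_eq]
  exact Subalgebra.smul_mem _ (diagForm_mem_center _ _ _) _

theorem omegaForm_mem_hodgeType : P.omegaForm ∈ hodgeType 1 1 := by
  rw [omegaForm_eq]
  exact Submodule.smul_mem _ _ (diagForm_mem_hodgeType pair_mem _)

theorem omegaForm_mem_degree : P.omegaForm ∈ ⋀[ℂ]^2 W := by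
  rw [omegaForm_eq]
  exact Submodule.smul_mem _ _ (diagForm_mem_degree _ _ _)

theorem A₁_mem_degree : P.A₁ ∈ ⋀[ℂ]^2 W := by
  rw [A₁_eq]
  exact add_mem (skewForm_mem_degree _ _) (skewForm_mem_degree _ _)

theorem A₂_mem_degree (c : ℤ) : P.A₂ c ∈ ⋀[ℂ]^2 W := by
  rw [A₂_eq]
  exact Submodule.smul_mem _ _ (sub_mem (skewForm_mem_degree _ _) (skewForm_mem_degree _ _))

theorem M_mem_degree : P.M ∈ ⋀[ℂ]^4 W := by
  have h : ∀ a b c d : W, oneForm a * oneForm b * oneForm c * oneForm d ∈ ⋀[ℂ]^4 W := by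
    intro a b c d
    rw [mul_assoc]
    exact SetLike.mul_mem_graded (A := fun i : ℕ => ⋀[ℂ]^i W) (i := 2) (j := 2)
      (two_mem_degree _ _) (two_mem_degree _ _)
  rw [M_eq]
  exact Submodule.smul_mem _ _ (add_mem (h _ _ _ _) (h _ _ _ _))

theorem M_mul_omegaForm : P.M * P.omegaForm = 0 := by
  have h : (2 : ℂ) • (P.M * P.omegaForm) = 0 := by
    rw [← smul_mul_assoc, ← skewForm_sq_add, add_mul, P.skewForm_sq_mul_omegaForm.1,
      P.skewForm_sq_mul_omegaForm.2, add_zero]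
  exact (smul_eq_zero.mp h).resolve_left two_ne_zero

theorem A₁_sq_mul_omegaForm_mem : P.A₁ ^ 2 * P.omegaForm ∈ hodgeType 3 3 := by
  have hc := Subalgebra.mem_center_iff.mp (skewForm_mem_center P.h evenFun) (skewForm P.h oddFun)
  have h : P.A₁ ^ 2 * P.omegaForm
      = (2 : ℂ) • (skewForm P.h evenFun * skewForm P.h oddFun * P.omegaForm) := by
    have : P.A₁ ^ 2 = skewForm P.h evenFun ^ 2 + skewForm P.h oddFun ^ 2
        + (2 : ℂ) • (skewForm P.h evenFun * skewForm P.h oddFun) := by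
      rw [A₁_eq, sq, mul_add, add_mul, add_mul, hc, two_smul, sq, sq]
      abel
    rw [this, add_mul, add_mul, P.skewForm_sq_mul_omegaForm.1, P.skewForm_sq_mul_omegaForm.2,
      zero_add, zero_add, smul_mul_assoc]
  rw [h, omegaForm_eq, mul_smul_comm]
  obtain ⟨o1, o2, o3, o4, o5, o6⟩ := P.orthogonality
  obtain ⟨K, hK⟩ := skewForm_mul_skewForm_mul_diagForm P.h_swap (fun j => (P.μ j : ℂ))
    evenFun oddFun (by simpa [Quartic.h] using congrArg Complex.ofReal o1)
    (by simpa [Quartic.h] using congrArg Complex.ofReal o2)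
    (by simpa [Quartic.h] using congrArg Complex.ofReal o3)
    (by simpa [Quartic.h] using congrArg Complex.ofReal o4)
    (by simpa [Quartic.h] using congrArg Complex.ofReal o5)
    (by simpa [Quartic.h] using congrArg Complex.ofReal o6)
  rw [hK]
  exact Submodule.smul_mem _ _ (Submodule.smul_mem _ _ (sum_mem fun i _ =>
    Submodule.smul_mem _ _ (tripleForm_mem_hodgeType pair_mem i)))

/-- The component of degree 6 of the Chern character. -/
def rho₆ (n k : ℕ) : Form :=
  (n : ℂ) • (((k : ℂ) ^ 3 / 3) • P.omegaForm ^ 3 + (k : ℂ) • (P.A₁ ^ 2 * P.omegaForm))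

/-- The component of degree 8 of the Chern character. -/
def rho₈ (c : ℤ) (n k : ℕ) : Form :=
  ((n : ℂ) / 24) • ((P.A₁ + (k : ℂ) • P.omegaForm) ^ 4 + (-P.A₁ + (k : ℂ) • P.omegaForm) ^ 4)
    - (12⁻¹ : ℂ) • P.A₂ c ^ 4

theorem chernCharacter_eq (c : ℤ) {n : ℕ} (hn : n = c.natAbs ^ 2 * P.Δ) (k : ℕ) :
    (n : ℂ) • (expForm (P.A₁ + (k : ℂ) • P.omegaForm) + expForm (-P.A₁ + (k : ℂ) • P.omegaForm))
      - (expForm (P.A₂ c) + expForm (-P.A₂ c))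
      = (2 * (n : ℂ) * (k : ℂ)) • P.omegaForm + (4 * (n : ℂ)) • P.M
        + ((k : ℂ) ^ 2 * (n : ℂ)) • P.omegaForm ^ 2
        + ((2 * (n : ℂ) - 2) • (1 : Form) + P.rho₆ n k + P.rho₈ c n k) := by
  have hg : (Complex.I * c * P.𝔻) ^ 2 = -(n : ℂ) := by
    have h1 : (n : ℝ) = (c : ℝ) ^ 2 * P.𝔻 ^ 2 := by
      rw [hn, ← Δ_eq_𝔻]
      push_cast
      rw [Nat.cast_natAbs, Int.cast_abs, sq_abs]
    have h2 : (n : ℂ) = (c : ℂ) ^ 2 * (P.𝔻 : ℂ) ^ 2 := by exact_mod_cast h1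
    rw [mul_pow, mul_pow, Complex.I_sq, h2]
    ring
  have h := expForm_identity (skewForm_mem_center P.h evenFun) (skewForm_mem_center P.h oddFun)
    P.omegaForm_mem_center (k : ℂ) hg
  rw [← A₂_eq, ← A₁_eq, skewForm_sq_add, smul_smul, show 2 * (n : ℂ) * 2 = 4 * n by ring] at h
  exact h

theorem rho₆_mem_hodgeType (n k : ℕ) : P.rho₆ n k ∈ hodgeType 3 3 := by
  have h3 : P.omegaForm ^ 3 ∈ hodgeType 3 3 := by
    rw [pow_succ, pow_two]
    exact hodgeType_mul (p := 2) (q := 2) (p' := 1) (q' := 1)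
      (hodgeType_mul (p := 1) (q := 1) (p' := 1) (q' := 1) P.omegaForm_mem_hodgeType
        P.omegaForm_mem_hodgeType) P.omegaForm_mem_hodgeType
  exact Submodule.smul_mem _ _ (add_mem (Submodule.smul_mem _ _ h3)
    (Submodule.smul_mem _ _ P.A₁_sq_mul_omegaForm_mem))

theorem pow_mem_degree {α : Form} (h : α ∈ ⋀[ℂ]^2 W) (m : ℕ) : α ^ m ∈ ⋀[ℂ]^(m * 2) W :=
  SetLike.pow_mem_graded (A := fun i : ℕ => ⋀[ℂ]^i W) m h

theorem rho₆_mem_degree (n k : ℕ) : P.rho₆ n k ∈ ⋀[ℂ]^6 W :=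
  Submodule.smul_mem _ _ (add_mem (Submodule.smul_mem _ _ (pow_mem_degree P.omegaForm_mem_degree 3))
    (Submodule.smul_mem _ _ (SetLike.mul_mem_graded (A := fun i : ℕ => ⋀[ℂ]^i W) (i := 4) (j := 2)
      (pow_mem_degree P.A₁_mem_degree 2) P.omegaForm_mem_degree)))

theorem rho₈_mem_degree (c : ℤ) (n k : ℕ) : P.rho₈ c n k ∈ ⋀[ℂ]^8 W := by
  have hw := Submodule.smul_mem _ (k : ℂ) P.omegaForm_mem_degree
  exact sub_mem (Submodule.smul_mem _ _
    (add_mem (pow_mem_degree (add_mem P.A₁_mem_degree hw) 4)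
      (pow_mem_degree (add_mem (neg_mem P.A₁_mem_degree) hw) 4)))
    (Submodule.smul_mem _ _ (pow_mem_degree (P.A₂_mem_degree c) 4))

theorem degPart_of_mem {i : ℕ} {α : Form} (h : α ∈ ⋀[ℂ]^i W) (m : ℕ) :
    degPart m α = if i = m then α else 0 := by
  rw [degPart, GradedRing.proj_apply]
  split_ifs with him
  · subst him
    exact DirectSum.decompose_of_mem_same (fun i : ℕ => ⋀[ℂ]^i W) h
  · exact DirectSum.decompose_of_mem_ne (fun i : ℕ => ⋀[ℂ]^i W) h him

theorem one_mem_degree (r : ℂ) : r • (1 : Form) ∈ ⋀[ℂ]^0 W :=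
  Submodule.smul_mem _ _ (SetLike.GradedOne.one_mem (A := fun i : ℕ => ⋀[ℂ]^i W))

theorem chern_classes (c : ℤ) (n k : ℕ) {χ : Form}
    (h : χ = (2 * (n : ℂ) * (k : ℂ)) • P.omegaForm + (4 * (n : ℂ)) • P.M
        + ((k : ℂ) ^ 2 * (n : ℂ)) • P.omegaForm ^ 2
        + ((2 * (n : ℂ) - 2) • (1 : Form) + P.rho₆ n k + P.rho₈ c n k)) :
    c1OfCh χ = (2 * (n : ℂ) * (k : ℂ)) • P.omegaForm ∧
    c2OfCh χ = ((2 * (n : ℂ) ^ 2 - n) * (k : ℂ) ^ 2) • P.omegaForm ^ 2 - (4 * (n : ℂ)) • P.M := by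
  have hω := Submodule.smul_mem _ (2 * (n : ℂ) * (k : ℂ)) P.omegaForm_mem_degree
  have hM := Submodule.smul_mem _ (4 * (n : ℂ)) P.M_mem_degree
  have hω2 := Submodule.smul_mem _ ((k : ℂ) ^ 2 * (n : ℂ)) (pow_mem_degree P.omegaForm_mem_degree 2)
  have h1 := one_mem_degree (2 * (n : ℂ) - 2)
  have h6 := P.rho₆_mem_degree n k
  have h8 := P.rho₈_mem_degree c n k
  have hadd : ∀ (m : ℕ) (α β : Form), degPart m (α + β) = degPart m α + degPart m β :=
    fun m α β => map_add (GradedRing.proj (fun i : ℕ => ⋀[ℂ]^i W) m) α β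
  have e1 : c1OfCh χ = (2 * (n : ℂ) * (k : ℂ)) • P.omegaForm := by
    simp [h, c1OfCh, hadd, degPart_of_mem hω, degPart_of_mem hM, degPart_of_mem hω2,
      degPart_of_mem h1, degPart_of_mem h6, degPart_of_mem h8]
  refine ⟨e1, ?_⟩
  have e4 : degPart 4 χ = (4 * (n : ℂ)) • P.M + ((k : ℂ) ^ 2 * (n : ℂ)) • P.omegaForm ^ 2 := by
    simp [h, hadd, degPart_of_mem hω, degPart_of_mem hM, degPart_of_mem hω2,
      degPart_of_mem h1, degPart_of_mem h6, degPart_of_mem h8]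
  rw [c2OfCh, e1, e4, smul_pow]
  module

end Quartic

namespace Quartic

variable (P : Quartic)

/-! ### The embeddings of the field -/

theorem factor (y : ℂ) : (P.a : ℂ) * y ^ 4 + P.b * y ^ 2 + P.c * y + P.d
    = P.a * ((y - P.x 0) * (y - P.x 1) * (y - P.x 2) * (y - P.x 3)) := by
  have ha : P.a ≠ 0 := P.a_ne_zero
  obtain ⟨h1, h2, h3⟩ := P.root_sums_one
  have hB : (P.b : ℝ) = P.B * P.a := by rw [B]; push_cast; field_simp
  have hC : (P.c : ℝ) = P.C * P.a := by rw [C]; push_cast; field_simp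
  have h0 := congrArg (fun r : ℝ => (r : ℂ)) (P.isRoot 0)
  have k1 := congrArg (fun r : ℝ => (r : ℂ)) h1
  have k2 := congrArg (fun r : ℝ => (r : ℂ)) h2
  have k3 := congrArg (fun r : ℝ => (r : ℂ)) h3
  have kB := congrArg (fun r : ℝ => (r : ℂ)) hB
  have kC := congrArg (fun r : ℝ => (r : ℂ)) hC
  push_cast at h0 k1 k2 k3 kB kC
  -- The constant coefficient is eliminated with the root x₀, so Vieta's formula for the product of
  -- the roots is not needed.
  linear_combination h0 + (y ^ 2 - P.x 0 ^ 2) * kB + (y - P.x 0) * kC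
    - P.a * (y ^ 2 - P.x 0 ^ 2) * k2 + P.a * (y - P.x 0) * k3
    + P.a * (y ^ 3 - P.x 0 ^ 3) * k1

theorem exists_eq_root {y : ℂ} (h : (P.a : ℂ) * y ^ 4 + P.b * y ^ 2 + P.c * y + P.d = 0) :
    ∃ j, y = P.x j := by
  rw [factor] at h
  have ha : (P.a : ℂ) ≠ 0 := Rat.cast_ne_zero.mpr P.a_ne_zero
  simp only [mul_eq_zero, ha, false_or, sub_eq_zero] at h
  rcases h with ((h | h) | h) | h
  exacts [⟨0, h⟩, ⟨1, h⟩, ⟨2, h⟩, ⟨3, h⟩]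

theorem x_cast_injective {j l : Fin 4} (h : (P.x j : ℂ) = P.x l) : j = l :=
  P.strictAnti.injective (Complex.ofReal_injective h)

theorem φ_xGen (j : Fin 4) : P.φ j P.xGen = P.x j := (P.exists_embedding j).choose_spec.1

theorem φ_iDGen (j : Fin 4) : P.φ j P.iDGen = (-1) ^ (j : ℕ) * (Complex.I * P.𝔻) :=
  (P.exists_embedding j).choose_spec.2

instance numberField : NumberField P.F where
  to_finiteDimensional := by
    refine IntermediateField.finiteDimensional_adjoin fun s hs => ?_
    rcases hs with rfl | rfl
    · exact P.isIntegral_xGen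
    · exact P.isIntegral_iDGen

theorem algHom_ext {ψ χ : P.F →ₐ[ℚ] ℂ} (hx : ψ P.xGen = χ P.xGen) (hD : ψ P.iDGen = χ P.iDGen) :
    ψ = χ := by
  refine IntermediateField.algHom_ext_of_eq_adjoin ℚ (S := P.F)
    (s := {(P.x 0 : ℂ), Complex.I * (P.𝔻 : ℂ)}) rfl ?_
  rintro s (rfl | rfl)
  · exact hx
  · exact hD

/-- Complex conjugation as a homomorphism of `ℚ`-algebras. -/
def conjHom : ℂ →ₐ[ℚ] ℂ := (Complex.conjAe : ℂ →ₐ[ℝ] ℂ).restrictScalars ℚ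

theorem conjHom_apply (z : ℂ) : conjHom z = (starRingEnd ℂ) z := rfl

/-- The eight embeddings of `F`. -/
def embedding (p : Fin 4 ⊕ Fin 4) : P.F →ₐ[ℚ] ℂ :=
  Sum.elim P.φ (fun j => conjHom.comp (P.φ j)) p

theorem iD_ne_zero : Complex.I * (P.𝔻 : ℂ) ≠ 0 :=
  mul_ne_zero Complex.I_ne_zero (Complex.ofReal_ne_zero.mpr P.𝔻_pos.ne')

/-- An embedding sends x₀ to one of four distinct real roots and i𝔻 to ±i𝔻. Conjugation fixes the
root and changes the sign, so the φ_j and their conjugates exhaust the choices without repetition.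
-/
theorem embedding_bijective : Function.Bijective P.embedding := by
  have hne : ∀ j l : Fin 4, P.φ j ≠ conjHom.comp (P.φ l) := by
    intro j l h
    have h1 := DFunLike.congr_fun h P.xGen
    have h2 := DFunLike.congr_fun h P.iDGen
    simp only [AlgHom.comp_apply, φ_xGen, φ_iDGen, conjHom_apply, Complex.conj_ofReal] at h1 h2
    obtain rfl := P.x_cast_injective h1
    simp only [map_mul, map_pow, map_neg, map_one, Complex.conj_I, Complex.conj_ofReal] at h2
    have : (-1 : ℂ) ^ (j : ℕ) * (Complex.I * P.𝔻) = 0 := by linear_combination h2 / 2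
    exact mul_ne_zero (pow_ne_zero _ (by norm_num)) P.iD_ne_zero this
  constructor
  · rintro (j | j) (l | l) h
    · have := DFunLike.congr_fun h P.xGen
      simp only [embedding, Sum.elim_inl, φ_xGen] at this
      rw [P.x_cast_injective this]
    · exact absurd h (hne j l)
    · exact absurd h.symm (hne l j)
    · have := DFunLike.congr_fun h P.xGen
      simp only [embedding, Sum.elim_inr, AlgHom.comp_apply, φ_xGen, conjHom_apply,
        Complex.conj_ofReal] at this
      rw [P.x_cast_injective this]
  · intro ψ
    obtain ⟨j, hj⟩ : ∃ j, ψ P.xGen = P.x j := by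
      refine P.exists_eq_root ?_
      have h0 : (P.a : P.F) * P.xGen ^ 4 + P.b * P.xGen ^ 2 + P.c * P.xGen + P.d = 0 := by
        apply Subtype.ext
        have := congrArg (fun r : ℝ => (r : ℂ)) (P.isRoot 0)
        simpa [xGen] using this
      simpa using congrArg ψ h0
    have hsq : ψ P.iDGen ^ 2 = (P.φ j P.iDGen) ^ 2 := by
      have h : P.iDGen ^ 2 = -((P.Δ : ℕ) : P.F) := by
        apply Subtype.ext
        simpa [iDGen] using P.iD_sq
      rw [← map_pow, ← map_pow, h]
      simp
    rcases sq_eq_sq_iff_eq_or_eq_neg.mp hsq with h | h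
    · refine ⟨Sum.inl j, P.algHom_ext ?_ ?_⟩
      · simp [embedding, φ_xGen, hj]
      · simp [embedding, h]
    · refine ⟨Sum.inr j, P.algHom_ext ?_ ?_⟩
      · simp [embedding, φ_xGen, hj, conjHom_apply]
      · simp [embedding, h, φ_iDGen, conjHom_apply]

theorem finrank_F : Module.finrank ℚ P.F = 8 := by
  rw [← AlgHom.card ℚ P.F ℂ, ← Fintype.card_of_bijective P.embedding_bijective]
  simp

theorem trace_eq (u : P.F) : ((Algebra.trace ℚ P.F u : ℚ) : ℂ)
    = ∑ j, (P.φ j u + (starRingEnd ℂ) (P.φ j u)) := by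
  have h := trace_eq_sum_embeddings (K := ℚ) (L := P.F) ℂ (x := u)
  rw [eq_ratCast] at h
  rw [h, ← P.embedding_bijective.sum_comp (fun ψ : P.F →ₐ[ℚ] ℂ => ψ u), Fintype.sum_sum_type,
    Finset.sum_add_distrib]
  rfl

/-! ### Rational classes -/

/-- The functional on `V` which is `u ↦ Tr (v u)` on `F`. -/
def traceFun (v : P.F) : W :=
  ∑ j, (P.φ j v • zFun j + (starRingEnd ℂ) (P.φ j v) • zbarFun j)

theorem traceFun_mem (v : P.F) : oneForm (P.traceFun v) ∈ rationalClasses P.lattice := by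
  refine Algebra.subset_adjoin ⟨P.traceFun v, ?_, rfl⟩
  rintro _ ⟨u, rfl⟩
  refine ⟨Algebra.trace ℚ P.F (v * algebraMap _ P.F u), ?_⟩
  rw [trace_eq]
  simp only [traceFun, sum_apply, add_apply, map_mul]
  rfl

/-- The functional `∑ x_j ^ p a_j`. -/
def powerFun (a : Fin 4 → W) (p : ℕ) : W := ∑ j, ((P.x j : ℂ) ^ p) • a j

theorem even_add_odd (j : Fin 4) :
    oneForm (evenFun j) + oneForm (oddFun j) = oneForm (zFun j) + oneForm (zbarFun j) := by
  obtain ⟨e0, e1, e2, e3⟩ := evenFun_eq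
  obtain ⟨o0, o1, o2, o3⟩ := oddFun_eq
  fin_cases j
  · simp only [Fin.zero_eta, e0, o0]
  · simp only [Fin.mk_one, e1, o1, add_comm]
  · simp only [Fin.reduceFinMk, e2, o2]
  · simp only [Fin.reduceFinMk, e3, o3, add_comm]

theorem even_sub_odd (j : Fin 4) : oneForm (evenFun j) - oneForm (oddFun j)
    = ((-1 : ℂ) ^ (j : ℕ)) • (oneForm (zFun j) - oneForm (zbarFun j)) := by
  obtain ⟨e0, e1, e2, e3⟩ := evenFun_eq
  obtain ⟨o0, o1, o2, o3⟩ := oddFun_eq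
  fin_cases j
  · simp [e0, o0]
  · simp [e1, o1]
  · simp [e2, o2]
  · simp [e3, o3, pow_succ]

/-- The class of `u ↦ Tr (x ^ p u)`. -/
def traceForm (p : ℕ) : Form := oneForm (P.powerFun evenFun p) + oneForm (P.powerFun oddFun p)

/-- The class of `u ↦ Tr (i𝔻 x ^ p u)`. -/
def traceFormD (p : ℕ) : Form :=
  (Complex.I * (P.𝔻 : ℂ)) • (oneForm (P.powerFun evenFun p) - oneForm (P.powerFun oddFun p))

theorem traceForm_mem (p : ℕ) : P.traceForm p ∈ rationalClasses P.lattice := by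
  convert P.traceFun_mem (P.xGen ^ p) using 1
  simp only [traceForm, powerFun, traceFun, oneForm, map_sum, map_add, map_smul, map_pow, φ_xGen,
    Complex.conj_ofReal, ← Finset.sum_add_distrib, ← smul_add]
  exact Finset.sum_congr rfl fun j _ => congrArg _ (even_add_odd j)

theorem traceFormD_mem (p : ℕ) : P.traceFormD p ∈ rationalClasses P.lattice := by
  convert P.traceFun_mem (P.xGen ^ p * P.iDGen) using 1
  simp only [traceFormD, powerFun, traceFun, oneForm, map_sum, map_add, map_smul, map_mul, map_pow,
    map_neg, map_one, φ_xGen, φ_iDGen, Complex.conj_ofReal, Complex.conj_I,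
    ← Finset.sum_sub_distrib, ← smul_sub, Finset.smul_sum]
  refine Finset.sum_congr rfl fun j _ => ?_
  rw [show ExteriorAlgebra.ι ℂ (evenFun j) - ExteriorAlgebra.ι ℂ (oddFun j) = _ from even_sub_odd j]
  module

theorem rat_smul_mem {Λ : Submodule ℤ V} {α : Form} (h : α ∈ rationalClasses Λ) (q : ℚ) :
    (q : ℂ) • α ∈ rationalClasses Λ := by
  rw [Rat.cast_smul_eq_qsmul]
  exact Subalgebra.smul_mem _ h q

theorem powerFun_mul (a b : Fin 4 → W) (p q : ℕ) :
    oneForm (P.powerFun a p) * oneForm (P.powerFun b q)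
      = ∑ j, ∑ l, ((P.x j : ℂ) ^ p * (P.x l : ℂ) ^ q) • (oneForm (a j) * oneForm (b l)) := by
  simp only [powerFun, oneForm, map_sum, map_smul, Finset.sum_mul_sum, smul_mul_smul_comm]

theorem skewForm_h_eq (a : Fin 4 → W) : skewForm P.h a
    = (P.B : ℂ) • (oneForm (P.powerFun a 1) * oneForm (P.powerFun a 0))
      + oneForm (P.powerFun a 3) * oneForm (P.powerFun a 0)
      + oneForm (P.powerFun a 2) * oneForm (P.powerFun a 1) := by
  have e : ∑ j, ∑ l, P.h j l • (oneForm (a j) * oneForm (a l))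
      = (P.B : ℂ) • (oneForm (P.powerFun a 1) * oneForm (P.powerFun a 0))
      - (P.B : ℂ) • (oneForm (P.powerFun a 0) * oneForm (P.powerFun a 1))
      + oneForm (P.powerFun a 3) * oneForm (P.powerFun a 0)
      - oneForm (P.powerFun a 0) * oneForm (P.powerFun a 3)
      + oneForm (P.powerFun a 2) * oneForm (P.powerFun a 1)
      - oneForm (P.powerFun a 1) * oneForm (P.powerFun a 2) := by
    simp only [powerFun_mul, Finset.smul_sum, ← Finset.sum_add_distrib, ← Finset.sum_sub_distrib]
    refine Finset.sum_congr rfl fun j _ => Finset.sum_congr rfl fun l _ => ?_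
    rw [h, hR]
    push_cast
    module
  rw [skewForm, e, oneForm_swap (P.powerFun a 1) (P.powerFun a 0),
    oneForm_swap (P.powerFun a 3) (P.powerFun a 0), oneForm_swap (P.powerFun a 2) (P.powerFun a 1)]
  module

theorem diagForm_μ_eq (a b : Fin 4 → W) : diagForm (fun j => (P.μ j : ℂ)) a b
    = oneForm (P.powerFun a 3) * oneForm (P.powerFun b 0)
      + oneForm (P.powerFun a 2) * oneForm (P.powerFun b 1)
      + oneForm (P.powerFun a 1) * oneForm (P.powerFun b 2)
      + oneForm (P.powerFun a 0) * oneForm (P.powerFun b 3)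
      + (P.B : ℂ) • (oneForm (P.powerFun a 1) * oneForm (P.powerFun b 0)
        + oneForm (P.powerFun a 0) * oneForm (P.powerFun b 1))
      + (P.C : ℂ) • (oneForm (P.powerFun a 0) * oneForm (P.powerFun b 0)) := by
  have e : diagForm (fun j => (P.μ j : ℂ)) a b
      = ∑ j, ∑ l, (P.kernel j l : ℂ) • (oneForm (a j) * oneForm (b l)) := by
    refine Finset.sum_congr rfl fun j _ => ?_
    rw [Finset.sum_eq_single j]
    · rw [kernel_eq, if_pos rfl]
    · intro l _ hl
      rw [kernel_eq, if_neg hl.symm, Complex.ofReal_zero, zero_smul]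
    · simp
  rw [e]
  simp only [powerFun_mul, Finset.smul_sum, ← Finset.sum_add_distrib]
  refine Finset.sum_congr rfl fun j _ => Finset.sum_congr rfl fun l _ => ?_
  rw [kernel]
  push_cast
  module

theorem iD_mul_self : Complex.I * (P.𝔻 : ℂ) * (Complex.I * P.𝔻) = -(P.Δ : ℂ) := by
  rw [← sq, iD_sq]

theorem Δ_ne_zero : (P.Δ : ℂ) ≠ 0 := by
  rw [← neg_ne_zero, ← iD_sq]
  exact pow_ne_zero _ P.iD_ne_zero

/-- With e and o the even and odd parts, this is half of (e_p + o_p)(e_q + o_q) + (e_p - o_p)(e_q -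
o_q); the second product is rational because (i𝔻)² = -Δ. -/
theorem even_mul_add_odd_mul_mem (p q : ℕ) :
    oneForm (P.powerFun evenFun p) * oneForm (P.powerFun evenFun q)
      + oneForm (P.powerFun oddFun p) * oneForm (P.powerFun oddFun q)
      ∈ rationalClasses P.lattice := by
  have h := rat_smul_mem (add_mem (mul_mem (P.traceForm_mem p) (P.traceForm_mem q))
    (rat_smul_mem (mul_mem (P.traceFormD_mem p) (P.traceFormD_mem q)) (-(P.Δ : ℚ)⁻¹))) (1 / 2)
  convert h using 1
  rw [traceFormD, traceFormD, smul_mul_smul_comm, iD_mul_self, smul_smul]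
  push_cast
  rw [neg_mul_neg, inv_mul_cancel₀ P.Δ_ne_zero, one_smul, traceForm, traceForm]
  simp only [mul_add, add_mul, mul_sub, sub_mul]
  module

theorem even_mul_sub_odd_mul_mem (p q : ℕ) :
    (Complex.I * (P.𝔻 : ℂ)) • (oneForm (P.powerFun evenFun p) * oneForm (P.powerFun evenFun q)
      - oneForm (P.powerFun oddFun p) * oneForm (P.powerFun oddFun q))
      ∈ rationalClasses P.lattice := by
  have h := rat_smul_mem (add_mem (mul_mem (P.traceForm_mem p) (P.traceFormD_mem q))
    (mul_mem (P.traceFormD_mem p) (P.traceForm_mem q))) (1 / 2)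
  convert h using 1
  simp only [traceForm, traceFormD, smul_mul_assoc, mul_smul_comm, mul_add, add_mul, mul_sub,
    sub_mul]
  push_cast
  module

/-- Symmetrizing (e_p - o_p)(e_q + o_q) in p and q kills the even-even and odd-odd products, since
covectors anticommute. The factor i/𝔻 equals i𝔻/Δ. -/
theorem even_mul_odd_mem (p q : ℕ) :
    (Complex.I / (P.𝔻 : ℂ)) • (oneForm (P.powerFun evenFun p) * oneForm (P.powerFun oddFun q)
      + oneForm (P.powerFun evenFun q) * oneForm (P.powerFun oddFun p))
      ∈ rationalClasses P.lattice := by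
  have h := rat_smul_mem (add_mem (mul_mem (P.traceFormD_mem p) (P.traceForm_mem q))
    (mul_mem (P.traceFormD_mem q) (P.traceForm_mem p))) (1 / (2 * P.Δ))
  convert h using 1
  have hD : (P.𝔻 : ℂ) ≠ 0 := Complex.ofReal_ne_zero.mpr P.𝔻_pos.ne'
  have hs : Complex.I / (P.𝔻 : ℂ) = Complex.I * P.𝔻 / P.Δ := by
    have := P.iD_sq
    rw [mul_pow, Complex.I_sq] at this
    rw [div_eq_div_iff hD P.Δ_ne_zero]
    linear_combination Complex.I * this
  simp only [traceForm, traceFormD, smul_mul_assoc, mul_add, sub_mul, hs]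
  rw [oneForm_swap (P.powerFun evenFun p) (P.powerFun oddFun q),
    oneForm_swap (P.powerFun evenFun q) (P.powerFun oddFun p),
    oneForm_swap (P.powerFun evenFun q) (P.powerFun evenFun p),
    oneForm_swap (P.powerFun oddFun q) (P.powerFun oddFun p)]
  push_cast
  module

theorem A₁_mem : P.A₁ ∈ rationalClasses P.lattice := by
  have h := add_mem (add_mem (rat_smul_mem (P.even_mul_add_odd_mul_mem 1 0) P.B)
    (P.even_mul_add_odd_mul_mem 3 0)) (P.even_mul_add_odd_mul_mem 2 1)
  convert h using 1
  rw [A₁_eq, skewForm_h_eq, skewForm_h_eq]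
  module

theorem A₂_mem (c : ℤ) : P.A₂ c ∈ rationalClasses P.lattice := by
  have h := rat_smul_mem (add_mem (add_mem (rat_smul_mem (P.even_mul_sub_odd_mul_mem 1 0) P.B)
    (P.even_mul_sub_odd_mul_mem 3 0)) (P.even_mul_sub_odd_mul_mem 2 1)) c
  convert h using 1
  rw [A₂_eq, skewForm_h_eq, skewForm_h_eq]
  push_cast
  module

theorem omegaForm_mem : P.omegaForm ∈ rationalClasses P.lattice := by
  have h := add_mem (add_mem (add_mem (P.even_mul_odd_mem 3 0) (P.even_mul_odd_mem 2 1))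
    (rat_smul_mem (P.even_mul_odd_mem 1 0) P.B))
    -- For p = q = 0 the symmetrized class counts its single product twice, hence the half.
    (rat_smul_mem (P.even_mul_odd_mem 0 0) (P.C * (1 / 2)))
  convert h using 1
  rw [omegaForm_eq, diagForm_μ_eq]
  push_cast
  module

theorem rho₆_mem (n k : ℕ) : P.rho₆ n k ∈ rationalClasses P.lattice := by
  have h := rat_smul_mem (add_mem (rat_smul_mem (pow_mem P.omegaForm_mem 3) ((k : ℚ) ^ 3 / 3))
    (rat_smul_mem (mul_mem (pow_mem P.A₁_mem 2) P.omegaForm_mem) k)) n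
  simpa [rho₆] using h

theorem rho₈_mem (c : ℤ) (n k : ℕ) : P.rho₈ c n k ∈ rationalClasses P.lattice := by
  have hw := rat_smul_mem P.omegaForm_mem k
  have h := sub_mem (rat_smul_mem (add_mem (pow_mem (add_mem P.A₁_mem hw) 4)
    (pow_mem (add_mem (neg_mem P.A₁_mem) hw) 4)) ((n : ℚ) / 24))
    (rat_smul_mem (pow_mem (P.A₂_mem c) 4) 12⁻¹)
  simpa [rho₈] using h

/-! ### The lattice -/

theorem covolume_lattice_pos : 0 < ZLattice.covolume P.lattice MeasureTheory.volume := by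
  classical
  let b := NumberField.integralBasis P.F
  have hli : LinearIndependent ℝ fun i => P.zMap (b i) := by
    rw [Fintype.linearIndependent_iff]
    intro g hg
    have hli' := (NumberField.canonicalEmbedding.latticeBasis P.F).linearIndependent
    rw [Fintype.linearIndependent_iff] at hli'
    have hφ : ∀ j, ∑ i, (g i : ℂ) * P.φ j (b i) = 0 := by
      intro j
      have := congrFun hg j
      simpa [Finset.sum_apply, zMap] using this
    have hall : ∀ ψ : P.F →ₐ[ℚ] ℂ, ∑ i, (g i : ℂ) * ψ (b i) = 0 := by
      intro ψ
      obtain ⟨p, rfl⟩ := P.embedding_bijective.2 ψ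
      rcases p with j | j
      · exact hφ j
      · have := congrArg (starRingEnd ℂ) (hφ j)
        simpa [embedding, conjHom_apply] using this
    -- The coefficients are real, so a relation in the four coordinates φ_j also holds for the
    -- conjugates, hence in all eight embeddings, where the integral basis is independent over ℂ.
    have h0 : ∑ i, (g i : ℂ) • NumberField.canonicalEmbedding.latticeBasis P.F i = 0 := by
      funext ψ
      simp only [NumberField.canonicalEmbedding.latticeBasis_apply, Finset.sum_apply, Pi.smul_apply,
        smul_eq_mul, Pi.zero_apply]
      exact hall ψ.toRatAlgHom
    intro i
    exact_mod_cast hli' (fun i => (g i : ℂ)) h0 i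
  have hcard : Fintype.card (Module.Free.ChooseBasisIndex ℤ (NumberField.RingOfIntegers P.F))
      = Module.finrank ℝ V := by
    rw [← Module.finrank_eq_card_basis b, finrank_F, Module.finrank_pi_fintype]
    simp [Complex.finrank_real_complex]
  have : Nonempty (Module.Free.ChooseBasisIndex ℤ (NumberField.RingOfIntegers P.F)) :=
    b.index_nonempty
  let bV := basisOfLinearIndependentOfCardEqFinrank hli hcard
  have hspan : P.lattice = Submodule.span ℤ (Set.range bV) := by
    have hr : Set.range bV = (P.zMap.comp
        (algebraMap (NumberField.RingOfIntegers P.F) P.F)).toAddMonoidHom.toIntLinearMap ''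
        Set.range (NumberField.RingOfIntegers.basis P.F) := by
      rw [← Set.range_comp]
      refine congrArg Set.range (funext fun i => ?_)
      simp [bV, b, NumberField.integralBasis_apply]
    rw [hr, ← Submodule.map_span, (NumberField.RingOfIntegers.basis P.F).span_eq, lattice,
      LinearMap.range_eq_map]
  rw [hspan]
  exact ZLattice.covolume_pos _ _

/-! ### The discriminant is not one -/

/-- If Δ = 1 then 𝔻 = 1 is fixed by every embedding of the splitting field. Since 𝔻 changes by the
sign of the induced permutation of the roots, all embeddings are even; there are at most 12 of them,
not 24. -/
theorem Δ_ne_one : P.Δ ≠ 1 := by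
  intro hΔ
  have hD : vandermonde P.x = 1 := by
    have h := P.Δ_eq_𝔻
    rw [hΔ, Nat.cast_one] at h
    have hp := P.𝔻_pos
    change P.𝔻 = 1
    nlinarith
  let L := IntermediateField.adjoin ℚ (Set.range P.x)
  let g : Fin 4 → L := fun j => ⟨P.x j, IntermediateField.subset_adjoin _ _ ⟨j, rfl⟩⟩
  have hfin : Module.finrank ℚ L = 24 := P.finrank_splitting
  have : FiniteDimensional ℚ L := Module.finite_of_finrank_pos (by rw [hfin]; norm_num)
  have hroot : ∀ (ψ : L →ₐ[ℚ] ℂ) j, ∃ l, ψ (g j) = P.x l := by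
    intro ψ j
    refine P.exists_eq_root ?_
    have h0 : (P.a : L) * g j ^ 4 + P.b * g j ^ 2 + P.c * g j + P.d = 0 := by
      apply Subtype.ext
      simpa [g] using P.isRoot j
    simpa using congrArg ψ h0
  choose s hs using hroot
  have hsi : ∀ ψ, Function.Injective (s ψ) := by
    intro ψ j l h
    have : ψ (g j) = ψ (g l) := by rw [hs, hs, h]
    exact P.strictAnti.injective (congrArg Subtype.val (ψ.injective this))
  let perm : (L →ₐ[ℚ] ℂ) → Equiv.Perm (Fin 4) := fun ψ =>
    Equiv.ofBijective (s ψ) (Finite.injective_iff_bijective.mp (hsi ψ))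
  have hsign : ∀ ψ, Equiv.Perm.sign (perm ψ) = 1 := by
    intro ψ
    have h1 : (g 0 - g 1) * (g 0 - g 2) * (g 0 - g 3) * (g 1 - g 2) * (g 1 - g 3) * (g 2 - g 3)
        = 1 := Subtype.ext hD
    have h2 := congrArg ψ h1
    simp only [map_mul, map_sub, map_one, hs] at h2
    have h3 : vandermonde (P.x ∘ perm ψ) = 1 := by
      have : ((vandermonde (P.x ∘ perm ψ) : ℝ) : ℂ) = 1 := by
        rw [← h2]
        simp [vandermonde, perm]
      exact_mod_cast this
    rw [vandermonde_comp, hD, mul_one] at h3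
    have h4 : ((Equiv.Perm.sign (perm ψ) : ℤˣ) : ℤ) = 1 := by exact_mod_cast h3
    exact Units.ext h4
  have hinj : Function.Injective fun ψ => (⟨perm ψ, hsign ψ⟩ :
      {σ : Equiv.Perm (Fin 4) // Equiv.Perm.sign σ = 1}) := by
    intro ψ χ h
    have hp : perm ψ = perm χ := congrArg Subtype.val h
    refine IntermediateField.algHom_ext_of_eq_adjoin ℚ (S := L) (s := Set.range P.x) rfl ?_
    rintro _ ⟨j, rfl⟩
    change ψ (g j) = χ (g j)
    rw [hs, hs]
    exact congrArg (fun l => (P.x l : ℂ)) (DFunLike.congr_fun hp j)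
  have hle := Fintype.card_le_of_injective _ hinj
  rw [AlgHom.card, hfin] at hle
  have h12 : Fintype.card {σ : Equiv.Perm (Fin 4) // Equiv.Perm.sign σ = 1} = 12 := by decide
  omega

end Quartic

/-! ### The top coefficient -/

theorem sum_pow_four {R : Type*} [CommRing R] {u v w z : R} (hu : u * u = 0) (hv : v * v = 0)
    (hw : w * w = 0) (hz : z * z = 0) : (u + v + w + z) ^ 4 = 24 * (u * v * w * z) := by
  have h1 : (u + v) ^ 2 = 2 * (u * v) := by linear_combination hu + hv
  have h2 : (w + z) ^ 2 = 2 * (w * z) := by linear_combination hw + hz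
  have h3 : (u + v) ^ 3 = 0 := by
    rw [pow_succ, h1]; linear_combination 2 * v * hu + 2 * u * hv
  have h4 : (w + z) ^ 3 = 0 := by
    rw [pow_succ, h2]; linear_combination 2 * z * hw + 2 * w * hz
  linear_combination (u + v) * h3 + 4 * (w + z) * h3 + 6 * (w + z) ^ 2 * h1 + 12 * u * v * h2
    + 4 * (u + v) * h4 + (w + z) * h4

/-- The four summands are central with square zero, so only the 4! orderings of their product
survive. -/
theorem diagForm_pow_four (m : Fin 4 → ℂ) (a b : Fin 4 → W) :
    diagForm m a b ^ 4 = (24 * (m 0 * m 1 * m 2 * m 3)) •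
      (oneForm (a 0) * oneForm (b 0) * (oneForm (a 1) * oneForm (b 1))
        * (oneForm (a 2) * oneForm (b 2)) * (oneForm (a 3) * oneForm (b 3))) := by
  let t : Fin 4 → Subalgebra.center ℂ Form := fun j =>
    ⟨oneForm (a j) * oneForm (b j), two_mem_center _ _⟩
  have ht : ∀ j, (m j • t j) * (m j • t j) = 0 := by
    intro j
    apply Subtype.ext
    change (m j • (oneForm (a j) * oneForm (b j))) * (m j • (oneForm (a j) * oneForm (b j))) = 0
    rw [smul_mul_smul_comm, mul_assoc, ← mul_assoc (oneForm (b j)), oneForm_swap (a j) (b j),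
      neg_mul, mul_neg, mul_assoc, oneForm_sq, mul_zero, mul_zero, neg_zero, smul_zero]
  have h := sum_pow_four (ht 0) (ht 1) (ht 2) (ht 3)
  have h' : (m 0 • t 0 + m 1 • t 1 + m 2 • t 2 + m 3 • t 3) ^ 4
      = (24 * (m 0 * m 1 * m 2 * m 3)) • (t 0 * t 1 * t 2 * t 3) := by
    rw [h]
    algebra
  have := congrArg (Subalgebra.center ℂ Form).val h'
  simp only [map_add, map_smul, map_pow, map_mul] at this
  rw [diagForm, Fin.sum_univ_four]
  exact this

/-- The covectors `z_0, \bar z_0, \bar z_1, z_1, z_2, \bar z_2, \bar z_3, z_3`. -/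
def allFun (a : Fin 8) : W :=
  if a.val % 2 = 0 then Quartic.evenFun ⟨a.val / 2, by omega⟩
  else Quartic.oddFun ⟨a.val / 2, by omega⟩

/-- The matrix is block diagonal in the four coordinates, with block determinants -2i for even j and
2i for odd j. -/
theorem det_allFun : (Matrix.of fun a b : Fin 8 =>
    allFun a (Pi.single ⟨b.val / 2, by omega⟩ (Complex.I ^ (b.val % 2)))).det = 16 := by
  let N : Fin 4 → Matrix (Fin 2) (Fin 2) ℂ := fun j =>
    if j.val % 2 = 0 then !![1, Complex.I; 1, -Complex.I] else !![1, -Complex.I; 1, Complex.I]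
  let e : Fin 2 × Fin 4 ≃ Fin 8 := (Equiv.prodComm _ _).trans finProdFinEquiv
  obtain ⟨e0, e1, e2, e3⟩ := Quartic.evenFun_eq
  obtain ⟨o0, o1, o2, o3⟩ := Quartic.oddFun_eq
  have hN : Matrix.blockDiagonal N = (Matrix.of fun a b : Fin 8 =>
      allFun a (Pi.single ⟨b.val / 2, by omega⟩ (Complex.I ^ (b.val % 2)))).submatrix e e := by
    have he : ∀ i j, (e (i, j)).val = i.val + 2 * j.val := fun i j => rfl
    ext ⟨i, j⟩ ⟨i', j'⟩
    have h1 : (⟨(e (i, j)).val / 2, by omega⟩ : Fin 4) = j := Fin.ext (by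
      change (e (i, j)).val / 2 = j.val
      rw [he]; omega)
    have h2 : (⟨(e (i', j')).val / 2, by omega⟩ : Fin 4) = j' := Fin.ext (by
      change (e (i', j')).val / 2 = j'.val
      rw [he]; omega)
    have h3 : (e (i, j)).val % 2 = i.val := by rw [he]; omega
    have h4 : (e (i', j')).val % 2 = i'.val := by rw [he]; omega
    simp only [Matrix.submatrix_apply, Matrix.of_apply, allFun, h1, h2, h3, h4,
      Matrix.blockDiagonal_apply]
    have hz : ∀ (j l : Fin 4) (z : ℂ), zFun j (Pi.single l z) = if j = l then z else 0 := by
      intro j l z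
      simp [zFun, Pi.single_apply]
    have hzb : ∀ (j l : Fin 4) (z : ℂ), zbarFun j (Pi.single l z)
        = if j = l then (starRingEnd ℂ) z else 0 := by
      intro j l z
      simp only [zbarFun, ContinuousLinearMap.comp_apply, hz]
      split_ifs <;> simp
    fin_cases j <;> fin_cases i <;> fin_cases i' <;> simp [N, e0, e1, e2, e3, o0, o1, o2, o3, hz, hzb]
  rw [← Matrix.det_submatrix_equiv_self e, ← hN, Matrix.det_blockDiagonal, Fin.prod_univ_four]
  simp only [N, Fin.val_zero, Fin.val_one, Fin.val_two, Nat.zero_mod]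
  norm_num [Matrix.det_fin_two_of]
  linear_combination (16 * Complex.I ^ 2 - 16) * Complex.I_sq

theorem topCoeff_prod : topCoeff
    (oneForm (Quartic.evenFun 0) * oneForm (Quartic.oddFun 0)
      * (oneForm (Quartic.evenFun 1) * oneForm (Quartic.oddFun 1))
      * (oneForm (Quartic.evenFun 2) * oneForm (Quartic.oddFun 2))
      * (oneForm (Quartic.evenFun 3) * oneForm (Quartic.oddFun 3))) = 16 := by
  have h : oneForm (Quartic.evenFun 0) * oneForm (Quartic.oddFun 0)
      * (oneForm (Quartic.evenFun 1) * oneForm (Quartic.oddFun 1))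
      * (oneForm (Quartic.evenFun 2) * oneForm (Quartic.oddFun 2))
      * (oneForm (Quartic.evenFun 3) * oneForm (Quartic.oddFun 3))
      = ExteriorAlgebra.ιMulti ℂ 8 allFun := by
    rw [ExteriorAlgebra.ιMulti_apply]
    simp only [mul_assoc, List.ofFn_succ, List.ofFn_zero, List.prod_cons, List.prod_nil, mul_one]
    rfl
  rw [h, topCoeff, ExteriorAlgebra.liftAlternating_apply_ιMulti, Pi.single_eq_same]
  refine Eq.trans ?_ det_allFun
  rw [AlternatingMap.compLinearMap_apply]
  exact congrArg Matrix.det (Matrix.ext fun a b => rfl)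

/-! ### The integral of ω⁴ and the rank -/

namespace Quartic

variable (P : Quartic)

/-- The constant is 24 · 16 from `diagForm_pow_four` and `topCoeff_prod`, times ∏ μ_j = 𝔻² and
(i/𝔻)⁴ = 𝔻⁻⁴. -/
theorem topCoeff_omegaForm_pow : topCoeff (P.omegaForm ^ 4) = ((384 / P.𝔻 ^ 2 : ℝ) : ℂ) := by
  have hD : (P.𝔻 : ℂ) ≠ 0 := Complex.ofReal_ne_zero.mpr P.𝔻_pos.ne'
  have hμ : (P.μ 0 : ℂ) * P.μ 1 * P.μ 2 * P.μ 3 = (P.𝔻 : ℂ) ^ 2 := by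
    exact_mod_cast congrArg (fun r : ℝ => (r : ℂ)) P.prod_μ
  rw [omegaForm_eq, smul_pow, diagForm_pow_four, map_smul, map_smul, topCoeff_prod, hμ]
  push_cast
  simp only [smul_eq_mul, div_pow, Complex.I_pow_four]
  field_simp
  norm_num

theorem integral_omegaForm_pow : integral P.lattice (P.omegaForm ^ 4)
    = ((ZLattice.covolume P.lattice MeasureTheory.volume * (384 / P.𝔻 ^ 2) : ℝ) : ℂ) := by
  rw [integral, topCoeff_omegaForm_pow, Complex.ofReal_mul]

theorem integral_smul {Λ : Submodule ℤ V} (r : ℂ) (α : Form) :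
    integral Λ (r • α) = r * integral Λ α := by
  rw [integral, integral, map_smul, smul_eq_mul]
  ring

theorem Δ_pos : 0 < P.Δ := by
  have h : (0 : ℝ) < P.Δ := by
    rw [Δ_eq_𝔻]
    exact pow_pos P.𝔻_pos 2
  exact_mod_cast h

theorem two_le {c : ℤ} (hc : c ≠ 0) {n : ℕ} (hn : n = c.natAbs ^ 2 * P.Δ) : 2 ≤ n := by
  have h1 : 2 ≤ P.Δ := by
    have := P.Δ_pos
    have := P.Δ_ne_one
    omega
  have h2 : 0 < c.natAbs ^ 2 := pow_pos (Int.natAbs_pos.mpr hc) 2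
  rw [hn]
  exact h1.trans (Nat.le_mul_of_pos_left _ h2)

theorem rank_virtualE {Λ : Submodule ℤ V} (L₁ L₂ K : LineBundle Λ) (n : ℕ) :
    (virtualE L₁ L₂ K n).rank = 2 * ((n : ℤ) - 1) := by
  simp [VirtualBundle.rank]
  ring

end Quartic

end

end AbelianFourfold
-- The main theorem
open AbelianFourfold in
theorem mainTheorem2 (P : Quartic) (c : ℤ) (hc : c ≠ 0) (k : ℕ) (hk : 0 < k)
    (L₁ L₂ K : LineBundle P.lattice)
    (hL₁ : L₁.IsFirstChernClass P.A₁)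
    (hL₂ : L₂.IsFirstChernClass (P.A₂ c))
    (hK : K.IsFirstChernClass ((k : ℂ) • P.omegaForm))
    (n : ℕ) (hn : n = c.natAbs ^ 2 * P.Δ) :
    ∃ χ : Form,
      (Quartic.virtualE L₁ L₂ K n).IsChernCharacter χ ∧
      (∃ ρ₀ ∈ rationalClasses P.lattice, ∃ ρ₆ ∈ rationalClasses P.lattice,
        ∃ ρ₈ ∈ rationalClasses P.lattice,
          ρ₀ ∈ ⋀[ℂ]^0 W ∧ ρ₆ ∈ hodgeType 3 3 ∧ ρ₈ ∈ ⋀[ℂ]^8 W ∧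
          χ = (2 * (n : ℂ) * (k : ℂ)) • P.omegaForm + (4 * (n : ℂ)) • P.M
              + ((k : ℂ) ^ 2 * (n : ℂ)) • P.omegaForm ^ 2 + (ρ₀ + ρ₆ + ρ₈)) ∧
      (Quartic.virtualE L₁ L₂ K n).rank = 2 * ((n : ℤ) - 1) ∧
      0 < (Quartic.virtualE L₁ L₂ K n).rank ∧
      ∃ p q w : ℝ,
        integral P.lattice (c2OfCh χ * P.omegaForm ^ 2) = (p : ℂ) ∧
        integral P.lattice (c1OfCh χ ^ 2 * P.omegaForm ^ 2) = (q : ℂ) ∧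
        integral P.lattice (P.omegaForm ^ 4) = (w : ℂ) ∧
        p - (((Quartic.virtualE L₁ L₂ K n).rank : ℝ) - 1)
              / (2 * ((Quartic.virtualE L₁ L₂ K n).rank : ℝ)) * q
          = (n : ℝ) / ((n : ℝ) - 1) * (k : ℝ) ^ 2 * w ∧
        0 < (n : ℝ) / ((n : ℝ) - 1) * (k : ℝ) ^ 2 * w := by
  have hn2 : 2 ≤ n := P.two_le hc hn
  have hrank := Quartic.rank_virtualE L₁ L₂ K n
  refine ⟨_, virtualE_isChernCharacter hL₁ hL₂ hK n, ?_⟩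
  have hχ := P.chernCharacter_eq c hn k
  obtain ⟨h1, h2⟩ := P.chern_classes c n k hχ
  refine ⟨⟨_, ?_, _, P.rho₆_mem n k, _, P.rho₈_mem c n k, Quartic.one_mem_degree _,
    P.rho₆_mem_hodgeType n k, P.rho₈_mem_degree c n k, hχ⟩, hrank, by rw [hrank]; omega, ?_⟩
  · have := Quartic.rat_smul_mem (one_mem (rationalClasses P.lattice)) (2 * n - 2)
    simpa using this
  set w : ℝ := ZLattice.covolume P.lattice MeasureTheory.volume * (384 / P.𝔻 ^ 2) with hw
  have hwpos : 0 < w :=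
    mul_pos P.covolume_lattice_pos (div_pos (by norm_num) (pow_pos P.𝔻_pos 2))
  have hn1 : (0 : ℝ) < (n : ℝ) - 1 := by
    have : (2 : ℝ) ≤ n := by exact_mod_cast hn2
    linarith
  have hnpos : (0 : ℝ) < n := by linarith
  have hkpos : (0 : ℝ) < k := by exact_mod_cast hk
  -- These come from c₂ = (2n² - n)k²ω² - 4nM with Mω = 0, and from c₁ = 2nkω. With r = 2(n - 1) the
  -- Bogomolov coefficient is (2n² - n) - (2n - 3)n²/(n - 1) = n/(n - 1).
  refine ⟨(2 * (n : ℝ) ^ 2 - n) * (k : ℝ) ^ 2 * w, 4 * (n : ℝ) ^ 2 * (k : ℝ) ^ 2 * w, w,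
    ?_, ?_, P.integral_omegaForm_pow, ?_, by positivity⟩
  · rw [h2, sub_mul, smul_mul_assoc, smul_mul_assoc, ← pow_add, sq P.omegaForm, ← mul_assoc P.M,
      P.M_mul_omegaForm, zero_mul, smul_zero, sub_zero, Quartic.integral_smul,
      P.integral_omegaForm_pow, ← hw]
    push_cast
    ring
  · rw [h1, smul_pow, smul_mul_assoc, ← pow_add, Quartic.integral_smul,
      P.integral_omegaForm_pow, ← hw]
    push_cast
    ring
  · rw [hrank]
    push_cast
    field_simp
    ring
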